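/- Let $K$ be a commutative ring and $t\in K$. Let $\widehat\Lambda$ be the ring of all symmetric formal power series in $x_1,x_2,\dots$ over $K$, and let $\Lambda\subset\widehat\Lambda$ be the subring of those of bounded degree. Let $(\,,)\colon\widehat\Lambda\times\Lambda\to K$ be the Hall inner product, i.e. $(\sum_\lambda A_\lambda s_\lambda,\sum_\lambda B_\lambda s_\lambda)=\sum_\lambda A_\lambda B_\lambda$, where the $s_\lambda$ are the Schur functions, the first sum may be infinite and the second is finite. Let $\Delta\colon\Lambda\to\Lambda\otimes\Lambda$, $f\mapsto f(x,y)=f(x_1,x_2,\dots,y_1,y_2,\dots)$, be the coproduct, and for $F\in\widehat\Lambda$ let $F^\perp=((F,-)\otimes\mathrm{id})\circ\Delta\colon\Lambda\to\Lambda$. Let $H(t)=\sum_{i\ge0}t^ih_i\in\widehat\Lambda$, where $h_i$ is the $i$-th complete homogeneous symmetric function. For partitions $\mu\subset\lambda$ let $g_{\lambda/\mu}=\sum_T\prod_i x_i^{T(i)}$ be the dual stable Grothendieck polynomial, where $T$ runs over the reverse plane partitions of shape $\lambda/\mu$ (fillings of the boxes of $\lambda/\mu$ with positive integers that increase weakly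 along rows and columns) and $T(i)$ is the number of columns of $T$ that contain $i$; put $g_\lambda=g_{\lambda/\emptyset}$. Let $c(\lambda/\mu)$ be the number of columns of $\lambda/\mu$ that contain a box, and $c(\lambda)=c(\lambda/\emptyset)$. Then $H(t)^\perp\colon\Lambda\to\Lambda$ is a $K$-algebra automorphism, every $g_{\lambda/\mu}$ lies in $\Lambda$, and: (1) $H(t)^\perp(f)=f(t,x_1,x_2,\dots)$ for every $f\in\Lambda$. (2) For all partitions $\mu\subset\lambda$, $$H(t)^\perp(g_{\lambda/\mu})=\sum_{\mu\subset\nu\subset\lambda}t^{c(\lambda/\nu)}g_{\nu/\mu}=\sum_{\mu\subset\nu\subset\lambda}t^{c(\nu/\mu)}g_{\lambda/\nu},$$ and in particular, for every partition $\lambda$, $$H(t)^\perp(g_{\lambda})=\sum_{\nu\subset\lambda}t^{c(\lambda/\nu)}g_{\nu}=\sum_{\nu\subset\lambda}t^{c(\nu)}g_{\lambda/\nu}.$$ -/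

import Mathlib

open scoped TensorProduct

namespace SymFun

/-! ### Symmetric power series and symmetric functions

The variables `x₁, x₂, …` are indexed by `ℕ`, so `x_{i+1}` is `MvPowerSeries.X i`. -/

section Ring

variable (K : Type*) [CommRing K]

/-- The completed ring of symmetric functions: all symmetric formal power series in
`x₁, x₂, …`, i.e. the power series invariant under every permutation of the variables. -/
noncomputable def SymSeries : Subalgebra K (MvPowerSeries ℕ K) :=
  ⨅ σ : Equiv.Perm ℕ,
    AlgHom.equalizer (MvPowerSeries.rename (R := K) σ) (AlgHom.id K (MvPowerSeries ℕ K))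

/-- `f` has bounded degree: for some `d`, no monomial of degree greater than `d` occurs in it. -/
def BoundedDegree {K : Type*} [CommRing K] (f : MvPowerSeries ℕ K) : Prop :=
  ∃ d : ℕ, ∀ n : ℕ →₀ ℕ, d < n.degree → MvPowerSeries.coeff n f = 0

/-- The ring of symmetric functions: symmetric power series of bounded degree. -/
noncomputable def Sym : Subalgebra K (MvPowerSeries ℕ K) where
  carrier := {f | f ∈ SymSeries K ∧ BoundedDegree f}
  mul_mem' := by
    rintro f g ⟨hf, d, hd⟩ ⟨hg, e, he⟩
    refine ⟨mul_mem hf hg, d + e, fun n hn => ?_⟩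
    classical
    rw [MvPowerSeries.coeff_mul]
    refine Finset.sum_eq_zero fun p hp => ?_
    have h : p.1.degree + p.2.degree = n.degree := by
      rw [← map_add, Finset.HasAntidiagonal.mem_antidiagonal.mp hp]
    rcases Nat.lt_or_ge d p.1.degree with h1 | h1
    · rw [hd _ h1, zero_mul]
    · rw [he p.2 (by omega), mul_zero]
  add_mem' := by
    rintro f g ⟨hf, d, hd⟩ ⟨hg, e, he⟩
    refine ⟨add_mem hf hg, d + e, fun n hn => ?_⟩
    rw [map_add, hd n (by omega), he n (by omega), add_zero]
  algebraMap_mem' := by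
    intro r
    refine ⟨algebraMap_mem _ r, 0, fun n hn => ?_⟩
    classical
    rw [MvPowerSeries.algebraMap_apply, MvPowerSeries.coeff_C, if_neg]
    rintro rfl
    simp at hn

/-- The complete homogeneous symmetric function `h_i`: the sum of all monomials of degree `i`. -/
noncomputable def complete (i : ℕ) : MvPowerSeries ℕ K :=
  fun n => if n.degree = i then 1 else 0

/-- The power series `∑_{i ≥ 0} t^i h_i` (for every monomial the sum of the coefficients is
finite). -/
noncomputable def completeSeries {K : Type*} [CommRing K] (t : K) : MvPowerSeries ℕ K :=
  fun n => ∑ᶠ i : ℕ, t ^ i * MvPowerSeries.coeff n (complete K i)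

theorem completeSeries_coeff {K : Type*} [CommRing K] (t : K) (n : ℕ →₀ ℕ) :
    MvPowerSeries.coeff n (completeSeries t) = t ^ n.degree := by
  change (∑ᶠ i : ℕ, t ^ i * (if n.degree = i then (1 : K) else 0)) = _
  rw [finsum_eq_single _ n.degree]
  · simp
  · intro i hi
    rw [if_neg (Ne.symm hi), mul_zero]

theorem completeSeries_mem {K : Type*} [CommRing K] (t : K) :
    completeSeries t ∈ SymSeries K := by
  rw [SymSeries, Algebra.mem_iInf]
  intro σ
  rw [AlgHom.mem_equalizer]
  ext n
  obtain ⟨m, rfl⟩ : ∃ m : ℕ →₀ ℕ, m.embDomain σ.toEmbedding = n :=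
    ⟨n.embDomain σ.symm.toEmbedding, by
      ext i
      obtain ⟨j, rfl⟩ := σ.surjective i
      have h1 := Finsupp.embDomain_apply_self σ.toEmbedding
        (n.embDomain σ.symm.toEmbedding) j
      have h2 := Finsupp.embDomain_apply_self σ.symm.toEmbedding n (σ j)
      simp only [Equiv.coe_toEmbedding, Equiv.symm_apply_apply] at h1 h2
      rw [h1, h2]⟩
  have h := MvPowerSeries.coeff_embDomain_rename σ.toEmbedding (completeSeries t) m
  simp only [AlgHom.coe_id, id_eq]
  refine (Eq.trans ?_ h).trans ?_
  · rfl
  · rw [completeSeries_coeff, completeSeries_coeff]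
    congr 1
    rw [Finsupp.embDomain_eq_mapDomain, Finsupp.degree_mapDomain]

/-- The element `H(t) = ∑_{i ≥ 0} t^i h_i` of the completed ring of symmetric functions. -/
noncomputable def H {K : Type*} [CommRing K] (t : K) : SymSeries K :=
  ⟨completeSeries t, completeSeries_mem t⟩

/-- The substitution `f(x₁, x₂, …) ↦ f(t, x₁, x₂, …)`. The coefficient of `x^n` in the result
is `∑_k t^k a_k`, where `a_k` is the coefficient in `f` of the monomial `x₁^k · (x^n with every
variable shifted by one)`; the sum is finite if `f` has bounded degree. -/
noncomputable def substFirst {K : Type*} [CommRing K] (t : K) (f : MvPowerSeries ℕ K) :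
    MvPowerSeries ℕ K :=
  fun n => ∑ᶠ k : ℕ, t ^ k *
    MvPowerSeries.coeff (Finsupp.single 0 k + n.mapDomain Nat.succ) f

end Ring

/-! ### Schur functions and the Hall inner product -/

section Hall

variable (K : Type*) [CommRing K]

/-- The content of a semistandard tableau: the multiplicity of every entry. -/
noncomputable def content {lam : YoungDiagram} (T : SemistandardYoungTableau lam) : ℕ →₀ ℕ :=
  ∑ c ∈ lam.cells, Finsupp.single (T c.1 c.2) 1

/-- The Schur function `s_λ`, the generating function of the semistandard tableaux of
shape `λ`. -/
noncomputable def schur (lam : YoungDiagram) : MvPowerSeries ℕ K :=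
  fun n => (Nat.card {T : SemistandardYoungTableau lam // content T = n} : K)

/-- The (possibly infinite) linear combination `∑_λ A_λ s_λ` (for every monomial the sum of the
coefficients is finite, since `s_λ` is homogeneous of degree `|λ|`). -/
noncomputable def schurSum {K : Type*} [CommRing K] (A : YoungDiagram → K) : MvPowerSeries ℕ K :=
  fun n => ∑ᶠ lam : YoungDiagram, A lam * MvPowerSeries.coeff n (schur K lam)

open Classical in
/-- The coefficients `A_λ` in the expansion `F = ∑_λ A_λ s_λ` of a symmetric power series. (The
expansion exists and is unique for symmetric `F`, so that `else` never applies to those.) -/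
noncomputable def schurCoeff {K : Type*} [CommRing K] (F : MvPowerSeries ℕ K) :
    YoungDiagram → K :=
  if h : ∃ A : YoungDiagram → K, schurSum A = F then h.choose else 0

/-- The Hall inner product `(F, f)` of a symmetric power series and a symmetric function: the
bilinear pairing in which the Schur functions are orthonormal, i.e. `(F, f) = ∑_λ A_λ B_λ` for
`F = ∑_λ A_λ s_λ` and `f = ∑_λ B_λ s_λ`, the second sum being finite. -/
noncomputable def hall {K : Type*} [CommRing K] (F : SymSeries K) (f : Sym K) : K :=
  ∑ᶠ lam : YoungDiagram,
    schurCoeff (F : MvPowerSeries ℕ K) lam * schurCoeff (f : MvPowerSeries ℕ K) lam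

open Classical in
/-- The map `f ↦ (F, f)`, bundled as a linear map. (It is linear, so `else` never applies.) -/
noncomputable def hallLin {K : Type*} [CommRing K] (F : SymSeries K) : Sym K →ₗ[K] K :=
  if h : IsLinearMap K (hall F) then h.mk' (hall F) else 0

end Hall

/-! ### The coproduct and the operators `F^⊥` -/

section Coproduct

variable (K : Type*) [CommRing K]

/-- The canonical map from `Λ(x) ⊗ Λ(y)` to the power series in the two sets of variables
`x = (X (inl i))_i` and `y = (X (inr i))_i`, taking `a ⊗ b` to `a(x) b(y)`. -/
noncomputable def tensorToSeries : Sym K ⊗[K] Sym K →ₐ[K] MvPowerSeries (ℕ ⊕ ℕ) K :=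
  Algebra.TensorProduct.productMap
    ((MvPowerSeries.rename (R := K) (Function.Embedding.inl : ℕ ↪ ℕ ⊕ ℕ)).comp (Sym K).val)
    ((MvPowerSeries.rename (R := K) (Function.Embedding.inr : ℕ ↪ ℕ ⊕ ℕ)).comp (Sym K).val)

/-- The power series `f(x, y) = f(x₁, x₂, …, y₁, y₂, …)` for symmetric `f`: the variables of `f`
are listed as `x`'s and `y`'s by some bijection, whose choice does not matter. -/
noncomputable def twoAlphabets {K : Type*} [CommRing K] (f : MvPowerSeries ℕ K) :
    MvPowerSeries (ℕ ⊕ ℕ) K :=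
  MvPowerSeries.rename (R := K) Equiv.natSumNatEquivNat.symm f

open Classical in
/-- The coproduct `Δ` of the ring of symmetric functions: `Δ f` is the element of `Λ ⊗ Λ` which
is `f(x, y)` as a power series in `x` and `y`. (There is exactly one such element, so `else` never
applies.) -/
noncomputable def coproduct {K : Type*} [CommRing K] (f : Sym K) : Sym K ⊗[K] Sym K :=
  if h : ∃ T : Sym K ⊗[K] Sym K, tensorToSeries K T = twoAlphabets (f : MvPowerSeries ℕ K)
  then h.choose else 0

/-- The operator `F^⊥ = ((F, -) ⊗ id) ∘ Δ`, that is `F^⊥ f = ∑ (F, f₁) f₂` where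
`Δ f = ∑ f₁ ⊗ f₂`. -/
noncomputable def perp {K : Type*} [CommRing K] (F : SymSeries K) (f : Sym K) : Sym K :=
  TensorProduct.lid K (Sym K) ((hallLin F).rTensor (Sym K) (coproduct f))

end Coproduct

/-! ### Dual stable Grothendieck polynomials

A partition is a `YoungDiagram`, whose cells are the pairs (row, column), and containment of
partitions is `≤`. -/

section Grothendieck

/-- The boxes of the skew shape `λ/μ`. -/
def skewCells (lam mu : YoungDiagram) : Finset (ℕ × ℕ) := lam.cells \ mu.cells

/-- The number `c(λ/μ)` of columns of the skew shape `λ/μ`, i.e. of columns that contain a box. -/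
def numCols (lam mu : YoungDiagram) : ℕ := ((skewCells lam mu).image Prod.snd).card

/-- A reverse plane partition of shape `λ/μ`: a filling of the boxes that is weakly increasing
along every row and down every column. The entry `i : ℕ` stands for the positive integer
`i + 1`. -/
structure RPP (lam mu : YoungDiagram) where
  entry : {c : ℕ × ℕ // c ∈ skewCells lam mu} → ℕ
  row_weak : ∀ c d, c.1.1 = d.1.1 → c.1.2 ≤ d.1.2 → entry c ≤ entry d
  col_weak : ∀ c d, c.1.2 = d.1.2 → c.1.1 ≤ d.1.1 → entry c ≤ entry d

/-- The pairs (entry, column) such that the entry occurs in the column. -/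
def RPP.entryCols {lam mu : YoungDiagram} (T : RPP lam mu) : Finset (ℕ × ℕ) :=
  Finset.univ.image fun c : {c : ℕ × ℕ // c ∈ skewCells lam mu} => (T.entry c, c.1.2)

/-- The exponent of `x^T = ∏_i x_i^{T(i)}`, where `T(i)` is the number of columns of `T` that
contain `i`. -/
noncomputable def RPP.weight {lam mu : YoungDiagram} (T : RPP lam mu) : ℕ →₀ ℕ :=
  ∑ p ∈ T.entryCols, Finsupp.single p.1 1

theorem RPP.weight_apply {lam mu : YoungDiagram} (T : RPP lam mu) (i : ℕ) :
    T.weight i = (T.entryCols.filter fun p => p.1 = i).card := by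
  rw [RPP.weight, Finsupp.finsetSum_apply, Finset.card_filter]
  exact Finset.sum_congr rfl fun p _ => Finsupp.single_apply

/-- The dual stable Grothendieck polynomial `g_{λ/μ} = ∑_T x^T`, summed over the reverse plane
partitions of shape `λ/μ`. -/
noncomputable def dualGroth (K : Type*) [CommRing K] (lam mu : YoungDiagram) :
    MvPowerSeries ℕ K :=
  fun n => (Nat.card {T : RPP lam mu // T.weight = n} : K)

theorem finite_between (mu lam : YoungDiagram) :
    {nu : YoungDiagram | mu ≤ nu ∧ nu ≤ lam}.Finite := by
  refine Set.Finite.of_finite_image (f := YoungDiagram.cells)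
    (Set.Finite.subset lam.cells.powerset.finite_toSet ?_) ?_
  · rintro _ ⟨nu, ⟨-, h⟩, rfl⟩
    exact Finset.mem_coe.mpr (Finset.mem_powerset.mpr (YoungDiagram.cells_subset_iff.mpr h))
  · intro a _ b _ h
    exact YoungDiagram.ext h

/-- The finite set of the partitions `ν` with `μ ⊂ ν ⊂ λ`. -/
noncomputable def between (mu lam : YoungDiagram) : Finset YoungDiagram :=
  (finite_between mu lam).toFinset

end Grothendieck

end SymFun

/-! Since `(h_k, s_λ)` is the coefficient of `x₁^k` in `s_λ`, the functional `(H(t), -)` is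
evaluation at `x₁ = t`, `x₂ = x₃ = ⋯ = 0`. Hence `H(t)^⊥` is the substitution
`f ↦ f(t, x₁, x₂, …)`, which is multiplicative, and it is bijective because it differs from the
identity by a map that lowers degrees.

Removing the largest entry of a reverse plane partition again and again gives a chain of diagrams.
So the coefficient of `x^n` in `g_{λ/μ}` is the value at `(μ, λ)` of the product of the `E_{n i}` in
the incidence algebra of Young's lattice, where `E_k` is the indicator function of `c(λ/μ) = k`.
Both the symmetry of `g_{λ/μ}` and the agreement of the two sums express that the `E_k` commute,
that is, that the operators `U(x) φ λ = ∑_μ x^{c(λ/μ)} φ μ` do. Working column by column,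
`U(x) = ∏_j (1 - (1 - x) D_j) (1 - D_j)⁻¹`, where `D_j` removes a box from the `j`-th column.
Here `D_i` and `D_j` commute if `|i - j| ≥ 2`, and `D_{j+1} D_j` commutes with `D_j` and `D_{j+1}`;
these relations already imply that the products for `x` and for `y` commute.
-/

namespace SymFun

/-- The solution `φ` of the unitriangular system `φ i + S φ i = b i`, by recursion on the rank:
`S φ i` only depends on the values of `φ` at ranks smaller than that of `i`, so its other values
may be replaced by `0`. -/
noncomputable def solveUnitriangular {ι M : Type*} [AddGroup M] (rank : ι → ℕ)
    (S : (ι → M) → ι → M) (b : ι → M) (i : ι) : M :=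
  b i - S (fun j => if rank j < rank i then solveUnitriangular rank S b j else 0) i
termination_by rank i

theorem bijective_of_unitriangular {ι M : Type*} [AddGroup M] (rank : ι → ℕ)
    (S : (ι → M) → ι → M)
    (hS : ∀ φ ψ i, (∀ j, rank j < rank i → φ j = ψ j) → S φ i = S ψ i) :
    Function.Bijective fun φ i => φ i + S φ i := by
  constructor
  · intro φ ψ h
    suffices ∀ d i, rank i = d → φ i = ψ i from funext fun i => this _ i rfl
    intro d
    induction d using Nat.strong_induction_on with
    | _ d ih =>
      rintro i rfl
      have lower : S φ i = S ψ i := hS φ ψ i fun j hj => ih _ hj j rfl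
      simpa only [lower, add_left_inj] using congrFun h i
  · intro b
    refine ⟨solveUnitriangular rank S b, funext fun i => ?_⟩
    have lower : S (solveUnitriangular rank S b) i =
        S (fun j => if rank j < rank i then solveUnitriangular rank S b j else 0) i :=
      hS _ _ i fun j hj => (if_pos hj).symm
    dsimp only
    rw [lower, solveUnitriangular, sub_add_cancel]

theorem bijective_one_add_of_locally_nilpotent {R M : Type*} [Semiring R] [AddCommGroup M]
    [Module R M] (N : Module.End R M) (hN : ∀ f, ∃ k, (N ^ k) f = 0) :
    Function.Bijective (1 + N : Module.End R M) := by
  constructor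
  · refine (injective_iff_map_eq_zero _).mpr fun f hf => ?_
    obtain ⟨k, hk⟩ := hN f
    have geom : (∑ i ∈ Finset.range k, (-N) ^ i) * (1 + N) = 1 - (-N) ^ k := by
      rw [← geom_sum_mul_neg, sub_neg_eq_add]
    simpa [hf, hk, neg_pow N] using (LinearMap.congr_fun geom f).symm
  · intro f
    obtain ⟨k, hk⟩ := hN f
    have geom : (1 + N) * ∑ i ∈ Finset.range k, (-N) ^ i = 1 - (-N) ^ k := by
      rw [← mul_neg_geom_sum, sub_neg_eq_add]
    exact ⟨(∑ i ∈ Finset.range k, (-N) ^ i) f, by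
      simpa [hk, neg_pow N] using LinearMap.congr_fun geom f⟩

section DescendingProduct

/-- The product `A (n - 1) * ⋯ * A 1 * A 0`, the noncommutative analogue of
`∏ i ∈ range n, A i`. -/
def descProd {M : Type*} [Monoid M] (A : ℕ → M) : ℕ → M
  | 0 => 1
  | n + 1 => A n * descProd A n

theorem commute_descProd_left {M : Type*} [Monoid M] {A : ℕ → M} {b : M} {n : ℕ}
    (h : ∀ i < n, Commute (A i) b) : Commute (descProd A n) b := by
  induction n with
  | zero => exact Commute.one_left _
  | succ n ih => exact (h n n.lt_succ_self).mul_left (ih fun i hi => h i (hi.trans n.lt_succ_self))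

theorem descProd_mul_descProd {G : Type*} [Group G] {A B : ℕ → G} {n : ℕ}
    (far : ∀ i < n, Commute (A i) (B (n + 1))) :
    descProd A (n + 2) * descProd B (n + 2) =
      A (n + 1) * A n * (B (n + 1) * B n) * (A n * B n)⁻¹ *
        (descProd A (n + 1) * descProd B (n + 1)) := by
  have past : B (n + 1) * descProd A n = descProd A n * B (n + 1) :=
    (commute_descProd_left far).symm.eq
  simp only [descProd, mul_inv_rev, mul_assoc, inv_mul_cancel_left, mul_inv_cancel_left]
  rw [← mul_assoc (B (n + 1)) (descProd A n), past, mul_assoc]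

theorem commute_descProd {G : Type*} [Group G] {A B : ℕ → G}
    (same : ∀ i, Commute (A i) (B i))
    (far : ∀ i j, i + 2 ≤ j → Commute (A i) (B j))
    (far' : ∀ i j, i + 2 ≤ j → Commute (B i) (A j))
    (near : ∀ i, Commute (A (i + 1) * A i) (B (i + 1) * B i)) :
    ∀ n, Commute (descProd A n) (descProd B n)
  | 0 => Commute.one_left _
  | 1 => by simpa only [descProd, mul_one] using same 0
  | n + 2 => by
    rw [Commute, SemiconjBy, descProd_mul_descProd fun i hi => far i (n + 1) (by omega),
      descProd_mul_descProd fun i hi => far' i (n + 1) (by omega), (near n).eq, (same n).eq,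
      (commute_descProd same far far' near (n + 1)).eq]

theorem commute_inv_add_inv_inv_mul_inv {E : Type*} [Ring E] {a b : E} {u v : Eˣ}
    (hu : (u : E) = 1 - a) (hv : (v : E) = 1 - b)
    (ha : Commute (b * a) a) (hb : Commute (b * a) b) :
    Commute ((↑v⁻¹ : E) + ↑u⁻¹) (↑v⁻¹ * ↑u⁻¹) := by
  have hq : Commute (b * a) ↑u⁻¹ :=
    Commute.units_inv_right (hu ▸ (Commute.one_right _).sub_right ha)
  have hp : Commute (b * a) ↑v⁻¹ :=
    Commute.units_inv_right (hv ▸ (Commute.one_right _).sub_right hb)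
  have inv_mul : (↑v⁻¹ : E) * b = ↑v⁻¹ - 1 := by
    rw [← v.inv_mul, hv, mul_sub, mul_one, sub_sub_cancel]
  have mul_inv : a * (↑u⁻¹ : E) = ↑u⁻¹ - 1 := by
    rw [← u.mul_inv, hu, sub_mul, one_mul, sub_sub_cancel]
  have expand : b * a * (↑v⁻¹ * ↑u⁻¹) = ↑v⁻¹ * ↑u⁻¹ - ↑v⁻¹ - ↑u⁻¹ + (1 : E) := by
    calc b * a * (↑v⁻¹ * ↑u⁻¹) = (↑v⁻¹ * b) * (a * ↑u⁻¹) := by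
          rw [← mul_assoc, hp.eq]; simp only [mul_assoc]
      _ = (↑v⁻¹ - 1) * (↑u⁻¹ - 1) := by rw [inv_mul, mul_inv]
      _ = _ := by noncomm_ring
  have sum_eq : (↑v⁻¹ : E) + ↑u⁻¹ = ↑v⁻¹ * ↑u⁻¹ + 1 - b * a * (↑v⁻¹ * ↑u⁻¹) := by
    rw [expand]; abel
  rw [sum_eq]
  exact ((Commute.refl _).add_left (Commute.one_left _)).sub_left
    ((hp.mul_right hq).mul_left (Commute.refl _))

theorem commute_affine_mul_affine {R E : Type*} [CommRing R] [Ring E] [Algebra R E] {p q : E}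
    (h : Commute (p + q) (p * q)) (x y : R) :
    Commute (((1 - x) • 1 + x • p) * ((1 - x) • 1 + x • q))
      (((1 - y) • 1 + y • p) * ((1 - y) • 1 + y • q)) := by
  have expand (z : R) : ((1 - z) • 1 + z • p) * ((1 - z) • 1 + z • q) =
      ((1 - z) * (1 - z)) • (1 : E) + (z * (1 - z)) • (p + q) + (z * z) • (p * q) := by
    simp only [add_mul, mul_add, smul_mul_smul_comm, one_mul, mul_one, smul_add,
      mul_comm (1 - z) z]
    abel
  have scalars (r₁ r₂ r₃ : R) {c : E} (h₁ : Commute (p + q) c) (h₂ : Commute (p * q) c) :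
      Commute (r₁ • (1 : E) + r₂ • (p + q) + r₃ • (p * q)) c :=
    (((Commute.one_left c).smul_left r₁).add_left (h₁.smul_left r₂)).add_left (h₂.smul_left r₃)
  rw [expand, expand]
  exact scalars _ _ _ (scalars _ _ _ (.refl _) h.symm).symm (scalars _ _ _ h (.refl _)).symm

variable {R E : Type*} [CommRing R] [Ring E] [Algebra R E]

theorem coe_mul_inv_eq_affine {d : E} {u v : Eˣ} {x : R} (hu : (u : E) = 1 - (1 - x) • d)
    (hv : (v : E) = 1 - d) : ((u * v⁻¹ : Eˣ) : E) = (1 - x) • 1 + x • (↑v⁻¹ : E) := by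
  have split : (u : E) = (1 - x) • (v : E) + x • 1 := by
    rw [hu, hv, smul_sub, sub_smul 1 x (1 : E), one_smul]
    abel
  rw [Units.val_mul, split, add_mul, smul_mul_assoc, smul_mul_assoc, Units.mul_inv, one_mul]

theorem commute_descProd_fraction {D : ℕ → E} (u : R → ℕ → Eˣ)
    (hu : ∀ z j, (u z j : E) = 1 - z • D j)
    (far : ∀ i j, i + 2 ≤ j → Commute (D i) (D j))
    (left : ∀ j, Commute (D (j + 1) * D j) (D j))
    (right : ∀ j, Commute (D (j + 1) * D j) (D (j + 1))) (x y : R) (n : ℕ) :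
    Commute (descProd (fun j => u (1 - x) j * (u 1 j)⁻¹) n)
      (descProd (fun j => u (1 - y) j * (u 1 j)⁻¹) n) := by
  have units {i j : ℕ} (h : Commute (D i) (D j)) (z w : R) : Commute (u z i) (u w j) := by
    refine Commute.units_of_val ?_
    rw [hu, hu]
    exact (Commute.one_left _).sub_left
      (((Commute.one_right _).sub_right (h.smul_right w)).smul_left z)
  have fractions {i j : ℕ} (h : Commute (D i) (D j)) (z w : R) :
      Commute (u (1 - z) i * (u 1 i)⁻¹) (u (1 - w) j * (u 1 j)⁻¹) :=
    ((units h _ _).mul_right (units h _ _).inv_right).mul_left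
      ((units h _ _).mul_right (units h _ _).inv_right).inv_left
  have hu₁ (j : ℕ) : (u 1 j : E) = 1 - D j := by rw [hu, one_smul]
  refine commute_descProd (fun i => fractions (.refl _) x y)
    (fun i j h => fractions (far i j h) x y) (fun i j h => fractions (far i j h) y x)
    (fun i => Commute.units_of_val ?_) n
  simp only [Units.val_mul _ (u _ _ * _), coe_mul_inv_eq_affine (hu _ _) (hu₁ _)]
  exact commute_affine_mul_affine
    (commute_inv_add_inv_inv_mul_inv (hu₁ i) (hu₁ (i + 1)) (left i) (right i)) x y

end DescendingProduct

section Columns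

theorem youngDiagram_ext_colLen {lam mu : YoungDiagram} (h : ∀ j, lam.colLen j = mu.colLen j) :
    lam = mu := by
  ext ⟨i, j⟩
  rw [YoungDiagram.mem_cells, YoungDiagram.mem_cells, YoungDiagram.mem_iff_lt_colLen,
    YoungDiagram.mem_iff_lt_colLen, h]

theorem le_iff_colLen_le {lam mu : YoungDiagram} :
    mu ≤ lam ↔ ∀ j, mu.colLen j ≤ lam.colLen j := by
  constructor
  · intro h j
    by_contra! hlt
    exact (YoungDiagram.mem_iff_lt_colLen.mp (h (YoungDiagram.mem_iff_lt_colLen.mpr hlt))).false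
  · rintro h ⟨i, j⟩ hc
    exact YoungDiagram.mem_iff_lt_colLen.mpr ((YoungDiagram.mem_iff_lt_colLen.mp hc).trans_le (h j))

theorem colLen_eq_iff_forall_mem {lam : YoungDiagram} {j m : ℕ} :
    lam.colLen j = m ↔ ∀ i, (i, j) ∈ lam ↔ i < m := by
  simp only [YoungDiagram.mem_iff_lt_colLen]
  exact ⟨fun h _ => h ▸ Iff.rfl, fun h => eq_of_forall_lt_iff h⟩

theorem colLen_eq_zero {lam : YoungDiagram} {j : ℕ} (h : lam.rowLen 0 ≤ j) :
    lam.colLen j = 0 := by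
  by_contra h0
  have hmem := YoungDiagram.mem_iff_lt_colLen.mpr (Nat.pos_of_ne_zero h0)
  exact (YoungDiagram.mem_iff_lt_rowLen.mp hmem).not_ge h

theorem rowLen_mono {mu lam : YoungDiagram} (h : mu ≤ lam) (i : ℕ) :
    mu.rowLen i ≤ lam.rowLen i := by
  by_contra! hlt
  exact (YoungDiagram.mem_iff_lt_rowLen.mp (h (YoungDiagram.mem_iff_lt_rowLen.mpr hlt))).false

/-- The diagram `lam` with its `j`-th column shortened to length `a`, or to the length of the next
column if that is larger. -/
def setCol (lam : YoungDiagram) (j a : ℕ) : YoungDiagram where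
  cells := lam.cells.filter fun c => c.2 = j → c.1 < max a (lam.colLen (j + 1))
  isLowerSet := by
    rintro ⟨i, k⟩ ⟨i', k'⟩ ⟨hi, hk⟩ hc
    simp only [Finset.coe_filter, Set.mem_ofPred_eq, YoungDiagram.mem_cells] at hi hk hc ⊢
    refine ⟨lam.up_left_mem hi hk hc.1, ?_⟩
    rintro rfl
    rcases hk.eq_or_lt with rfl | hlt
    · exact hi.trans_lt (hc.2 rfl)
    · exact lt_max_of_lt_right
        (YoungDiagram.mem_iff_lt_colLen.mp (lam.up_left_mem hi hlt hc.1))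

theorem colLen_setCol (lam : YoungDiagram) (j a i : ℕ) :
    (setCol lam j a).colLen i =
      if i = j then min (lam.colLen j) (max a (lam.colLen (j + 1))) else lam.colLen i := by
  refine colLen_eq_iff_forall_mem.mpr fun r => ?_
  rw [← YoungDiagram.mem_cells]
  simp only [setCol, Finset.mem_filter, YoungDiagram.mem_cells, YoungDiagram.mem_iff_lt_colLen]
  split_ifs with h
  · subst h
    simp only [forall_const, lt_inf_iff]
  · simp only [h, false_imp_iff, and_true]

theorem setCol_colLen (lam : YoungDiagram) (j : ℕ) : setCol lam j (lam.colLen j) = lam :=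
  youngDiagram_ext_colLen fun i => by
    rw [colLen_setCol]
    split_ifs with h
    · rw [h, min_eq_left (le_max_left _ _)]
    · rfl

theorem setCol_setCol (lam : YoungDiagram) (j : ℕ) {a b : ℕ} (h : a ≤ b) :
    setCol (setCol lam j b) j a = setCol lam j a :=
  youngDiagram_ext_colLen fun i => by
    simp only [colLen_setCol, if_neg j.succ_ne_self, if_true]
    split_ifs <;> omega

variable {R : Type*} [CommRing R]

/-- The operator that removes the last box of the `j`-th column; a function is sent to `0` at the
diagrams where this box is not a corner. -/
def removeBox (R : Type*) [CommRing R] (j : ℕ) : Module.End R (YoungDiagram → R) where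
  toFun φ lam :=
    if lam.colLen (j + 1) < lam.colLen j then φ (setCol lam j (lam.colLen j - 1)) else 0
  map_add' φ ψ := by
    ext lam
    simp only [Pi.add_apply, ite_add_ite, add_zero]
  map_smul' r φ := by
    ext lam
    simp only [Pi.smul_apply, RingHom.id_apply, smul_ite, smul_zero]

theorem removeBox_apply (j : ℕ) (φ : YoungDiagram → R) (lam : YoungDiagram) :
    removeBox R j φ lam =
      if lam.colLen (j + 1) < lam.colLen j then φ (setCol lam j (lam.colLen j - 1)) else 0 := rfl

theorem commute_removeBox_of_add_two_le {i j : ℕ} (h : i + 2 ≤ j) :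
    Commute (removeBox R i) (removeBox R j) := by
  refine LinearMap.ext fun φ => funext fun lam => ?_
  simp only [Module.End.mul_apply, removeBox_apply, colLen_setCol]
  have swap (a b : ℕ) : setCol (setCol lam i a) j b = setCol (setCol lam j b) i a :=
    youngDiagram_ext_colLen fun k => by
      simp only [colLen_setCol]
      grind
  grind

theorem commute_removeBox_succ_mul_self (j : ℕ) :
    Commute (removeBox R (j + 1) * removeBox R j) (removeBox R j) := by
  refine LinearMap.ext fun φ => funext fun lam => ?_
  have anti := lam.colLen_anti j (j + 1) (by omega)
  simp only [Module.End.mul_apply, removeBox_apply, colLen_setCol]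
  split_ifs
  all_goals first | omega | rfl | skip
  congr 1
  refine youngDiagram_ext_colLen fun k => ?_
  simp only [colLen_setCol]
  grind

theorem commute_removeBox_succ_mul_self_succ (j : ℕ) :
    Commute (removeBox R (j + 1) * removeBox R j) (removeBox R (j + 1)) := by
  refine LinearMap.ext fun φ => funext fun lam => ?_
  have anti := lam.colLen_anti j (j + 1) (by omega)
  simp only [Module.End.mul_apply, removeBox_apply, colLen_setCol]
  split_ifs
  all_goals first | omega | rfl | skip
  congr 1
  refine youngDiagram_ext_colLen fun k => ?_
  simp only [colLen_setCol]
  grind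

theorem isUnit_one_sub_smul_removeBox (z : R) (j : ℕ) : IsUnit (1 - z • removeBox R j) := by
  have coe_eq : ⇑(1 - z • removeBox R j) = fun φ lam => φ lam + -(z • removeBox R j φ lam) :=
    funext₂ fun φ lam => sub_eq_add_neg (φ lam) _
  rw [Module.End.isUnit_iff, coe_eq]
  refine bijective_of_unitriangular (fun lam => lam.colLen j) _ fun φ ψ lam h => ?_
  simp only [removeBox_apply]
  split_ifs with hlam
  · rw [h _ (by simp only [colLen_setCol, if_true]; omega)]
  · rfl

/-- The operator `1 - z D`, where `D` removes a box from the `j`-th column, as a unit. -/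
noncomputable def oneSubRemoveBox (z : R) (j : ℕ) : (Module.End R (YoungDiagram → R))ˣ :=
  (isUnit_one_sub_smul_removeBox z j).unit

theorem coe_oneSubRemoveBox (z : R) (j : ℕ) :
    (oneSubRemoveBox z j : Module.End R (YoungDiagram → R)) = 1 - z • removeBox R j := rfl

theorem coe_oneSubRemoveBox_one (j : ℕ) :
    (oneSubRemoveBox (1 : R) j : Module.End R (YoungDiagram → R)) = 1 - removeBox R j := by
  rw [coe_oneSubRemoveBox, one_smul]

theorem sum_setCol_sub_removeBox (j : ℕ) (φ : YoungDiagram → R) :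
    (1 - removeBox R j)
      (fun lam => ∑ a ∈ Finset.Icc (lam.colLen (j + 1)) (lam.colLen j), φ (setCol lam j a)) =
      φ := by
  ext lam
  rw [LinearMap.sub_apply, Module.End.one_apply, Pi.sub_apply, removeBox_apply]
  split_ifs with h
  · obtain ⟨m, hm⟩ : ∃ m, lam.colLen j = m + 1 := Nat.exists_eq_succ_of_ne_zero (by omega)
    have top : min (m + 1) (max m (lam.colLen (j + 1))) = m := by omega
    simp only [colLen_setCol, if_neg j.succ_ne_self, if_true, hm, Nat.add_sub_cancel, top]
    rw [Finset.sum_Icc_succ_top (by omega), ← hm, setCol_colLen, add_sub_assoc,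
      ← sub_eq_zero, add_sub_assoc, sub_sub_cancel_left, ← sub_eq_add_neg, sub_eq_zero]
    exact Finset.sum_congr rfl fun a ha => by rw [setCol_setCol lam j (Finset.mem_Icc.mp ha).2]
  · rw [(lam.colLen_anti j (j + 1) j.le_succ).antisymm (not_lt.mp h), Finset.Icc_self,
      Finset.sum_singleton, setCol_colLen, sub_zero]

/-- The operator that shortens the `j`-th column in all possible ways, with weight `1` if the column
keeps its length and `x` otherwise. As a fraction in the operator `D` removing one box it is
`(1 - (1 - x) D) (1 - D)⁻¹ = 1 + x D + x D² + ⋯`. -/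
noncomputable def shortenCol (x : R) (j : ℕ) : (Module.End R (YoungDiagram → R))ˣ :=
  oneSubRemoveBox (1 - x) j * (oneSubRemoveBox 1 j)⁻¹

theorem shortenCol_apply (x : R) (j : ℕ) (φ : YoungDiagram → R) (lam : YoungDiagram) :
    (shortenCol x j : Module.End R (YoungDiagram → R)) φ lam =
      ∑ a ∈ Finset.Icc (lam.colLen (j + 1)) (lam.colLen j),
        (if a < lam.colLen j then x else 1) * φ (setCol lam j a) := by
  have inv_apply : (↑(oneSubRemoveBox (1 : R) j)⁻¹ : Module.End R (YoungDiagram → R)) φ =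
      fun lam => ∑ a ∈ Finset.Icc (lam.colLen (j + 1)) (lam.colLen j), φ (setCol lam j a) := by
    nth_rw 1 [← sum_setCol_sub_removeBox j φ]
    rw [← coe_oneSubRemoveBox_one, ← Module.End.mul_apply, Units.inv_mul, Module.End.one_apply]
  have split (a : ℕ) (ha : a ∈ Finset.Icc (lam.colLen (j + 1)) (lam.colLen j)) :
      (if a < lam.colLen j then x else 1) * φ (setCol lam j a) =
        (if a = lam.colLen j then (1 - x) * φ lam else 0) + x * φ (setCol lam j a) := by
    rcases (Finset.mem_Icc.mp ha).2.eq_or_lt with h | h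
    · rw [if_neg h.not_lt, if_pos h, h, setCol_colLen]
      ring
    · rw [if_pos h, if_neg h.ne, zero_add]
  rw [shortenCol, coe_mul_inv_eq_affine (coe_oneSubRemoveBox _ _) (coe_oneSubRemoveBox_one _),
    Finset.sum_congr rfl split, Finset.sum_add_distrib, Finset.sum_ite_eq', ← Finset.mul_sum,
    if_pos (Finset.right_mem_Icc.mpr (lam.colLen_anti j (j + 1) j.le_succ)), LinearMap.add_apply,
    LinearMap.smul_apply, LinearMap.smul_apply, inv_apply]
  rfl

theorem commute_descProd_shortenCol (x y : R) (n : ℕ) :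
    Commute (descProd (shortenCol x) n) (descProd (shortenCol y) n) :=
  commute_descProd_fraction oneSubRemoveBox coe_oneSubRemoveBox
    (fun _ _ h => commute_removeBox_of_add_two_le h) commute_removeBox_succ_mul_self
    commute_removeBox_succ_mul_self_succ x y n

end Columns

section Steps

theorem mem_between {mu nu lam : YoungDiagram} : nu ∈ between mu lam ↔ mu ≤ nu ∧ nu ≤ lam :=
  (finite_between mu lam).mem_toFinset

theorem le_setCol_iff {lam mu : YoungDiagram} {n a : ℕ}
    (ha : a ∈ Finset.Icc (lam.colLen (n + 1)) (lam.colLen n)) :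
    (mu ≤ setCol lam n a ∧ ∀ j, n ≤ j → mu.colLen j = (setCol lam n a).colLen j) ↔
      (mu ≤ lam ∧ ∀ j, n + 1 ≤ j → mu.colLen j = lam.colLen j) ∧ mu.colLen n = a := by
  have col : min (lam.colLen n) (max a (lam.colLen (n + 1))) = a := by
    rw [max_eq_left (Finset.mem_Icc.mp ha).1, min_eq_right (Finset.mem_Icc.mp ha).2]
  have hle := (Finset.mem_Icc.mp ha).2
  simp only [le_iff_colLen_le, colLen_setCol, col]
  grind

variable {R : Type*} [CommRing R]

open Classical in
theorem descProd_shortenCol_apply (x : R) (n : ℕ) (φ : YoungDiagram → R) (lam : YoungDiagram) :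
    (↑(descProd (shortenCol x) n) : Module.End R (YoungDiagram → R)) φ lam =
      ∑ mu ∈ between ⊥ lam with ∀ j, n ≤ j → mu.colLen j = lam.colLen j,
        (∏ j ∈ Finset.range n, if mu.colLen j < lam.colLen j then x else 1) * φ mu := by
  induction n generalizing lam with
  | zero =>
    rw [Finset.sum_eq_single_of_mem lam
      (Finset.mem_filter.mpr ⟨mem_between.mpr ⟨bot_le, le_rfl⟩, fun _ _ => rfl⟩)]
    · rw [Finset.prod_range_zero, one_mul]
      rfl
    · intro mu hmu hne
      exact absurd (youngDiagram_ext_colLen fun j => (Finset.mem_filter.mp hmu).2 j j.zero_le) hne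
  | succ n ih =>
    have maps (mu : YoungDiagram) (hmu : mu ∈
        (between ⊥ lam).filter fun mu => ∀ j, n + 1 ≤ j → mu.colLen j = lam.colLen j) :
        mu.colLen n ∈ Finset.Icc (lam.colLen (n + 1)) (lam.colLen n) := by
      rw [Finset.mem_filter, mem_between] at hmu
      rw [Finset.mem_Icc, ← hmu.2 (n + 1) le_rfl]
      exact ⟨mu.colLen_anti n (n + 1) n.le_succ, le_iff_colLen_le.mp hmu.1.2 n⟩
    rw [descProd, Units.val_mul, Module.End.mul_apply, shortenCol_apply,
      ← Finset.sum_fiberwise_of_maps_to maps]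
    refine Finset.sum_congr rfl fun a ha => ?_
    rw [ih, Finset.mul_sum]
    refine Finset.sum_congr (Finset.ext fun mu => ?_) fun mu hmu => ?_
    · simpa only [Finset.mem_filter, mem_between, bot_le, true_and] using le_setCol_iff ha
    · have left_cols : ∏ j ∈ Finset.range n,
          (if mu.colLen j < (setCol lam n a).colLen j then x else 1) =
          ∏ j ∈ Finset.range n, if mu.colLen j < lam.colLen j then x else 1 :=
        Finset.prod_congr rfl fun j hj => by
          rw [colLen_setCol, if_neg (Finset.mem_range.mp hj).ne]
      rw [left_cols, Finset.prod_range_succ, (Finset.mem_filter.mp hmu).2]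
      ring

theorem numCols_eq_card_filter_colLen_lt {lam mu : YoungDiagram} {n : ℕ}
    (hn : lam.rowLen 0 ≤ n) :
    numCols lam mu = {j ∈ Finset.range n | mu.colLen j < lam.colLen j}.card := by
  rw [numCols]
  congr 1
  ext j
  simp only [Finset.mem_image, skewCells, Finset.mem_sdiff, YoungDiagram.mem_cells, Prod.exists,
    Finset.mem_filter, Finset.mem_range, exists_eq_right, YoungDiagram.mem_iff_lt_colLen, not_lt]
  constructor
  · rintro ⟨i, hlam, hmu⟩
    refine ⟨?_, hmu.trans_lt hlam⟩
    by_contra! h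
    rw [colLen_eq_zero (hn.trans h)] at hlam
    exact i.not_lt_zero hlam
  · rintro ⟨-, h⟩
    exact ⟨mu.colLen j, h, le_rfl⟩

theorem descProd_shortenCol_apply_of_rowLen_le (x : R) {n : ℕ} (φ : YoungDiagram → R)
    {lam : YoungDiagram} (hn : lam.rowLen 0 ≤ n) :
    (↑(descProd (shortenCol x) n) : Module.End R (YoungDiagram → R)) φ lam =
      ∑ mu ∈ between ⊥ lam, x ^ numCols lam mu * φ mu := by
  classical
  rw [descProd_shortenCol_apply, Finset.filter_true_of_mem]
  · simp only [numCols_eq_card_filter_colLen_lt hn, ← Finset.prod_const, Finset.prod_filter]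
  · intro mu hmu j hj
    have hlam := colLen_eq_zero (hn.trans hj)
    have hle := le_iff_colLen_le.mp (mem_between.mp hmu).2 j
    omega

theorem sum_pow_numCols_mul_pow_numCols_comm (x y : R) (mu lam : YoungDiagram) :
    ∑ nu ∈ between mu lam, x ^ numCols lam nu * y ^ numCols nu mu =
      ∑ nu ∈ between mu lam, y ^ numCols lam nu * x ^ numCols nu mu := by
  classical
  have two_steps (x y : R) : ((descProd (shortenCol x) (lam.rowLen 0) *
      descProd (shortenCol y) (lam.rowLen 0) : (Module.End R (YoungDiagram → R))ˣ) :
      Module.End R (YoungDiagram → R)) (Pi.single mu 1) lam =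
      ∑ nu ∈ between mu lam, x ^ numCols lam nu * y ^ numCols nu mu := by
    have subset : between mu lam ⊆ between ⊥ lam := fun nu hnu =>
      mem_between.mpr ⟨bot_le, (mem_between.mp hnu).2⟩
    have second_step (nu : YoungDiagram) (hnu : nu ≤ lam) :
        (↑(descProd (shortenCol y) (lam.rowLen 0)) : Module.End R (YoungDiagram → R))
          (Pi.single mu 1) nu = if mu ≤ nu then y ^ numCols nu mu else 0 := by
      rw [descProd_shortenCol_apply_of_rowLen_le _ _ (rowLen_mono hnu 0)]
      simp only [Pi.single_apply, mul_ite, mul_one, mul_zero, Finset.sum_ite_eq', mem_between,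
        bot_le, true_and]
    rw [Units.val_mul, Module.End.mul_apply, descProd_shortenCol_apply_of_rowLen_le _ _ le_rfl,
      ← Finset.sum_subset subset]
    · refine Finset.sum_congr rfl fun nu hnu => ?_
      rw [mem_between] at hnu
      rw [second_step nu hnu.2, if_pos hnu.1]
    · intro nu hnu hnot
      rw [mem_between] at hnu hnot
      rw [second_step nu hnu.2, if_neg fun h => hnot ⟨h, hnu.2⟩, mul_zero]
  rw [← two_steps, ← two_steps, (commute_descProd_shortenCol x y _).eq]

theorem coeff_coeff_C_X_pow_mul_X_pow (a b k l : ℕ) :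
    (((Polynomial.C Polynomial.X : Polynomial (Polynomial R)) ^ a * Polynomial.X ^ b).coeff l).coeff
      k = if a = k ∧ b = l then 1 else 0 := by
  rw [← Polynomial.C_pow, Polynomial.coeff_C_mul_X_pow]
  split_ifs with h h' h'
  · rw [h'.1, Polynomial.coeff_X_pow_self]
  · rw [Polynomial.coeff_X_pow, if_neg fun hk => h' ⟨hk.symm, h.symm⟩]
  · exact absurd h'.2.symm h
  · rw [Polynomial.coeff_zero]

theorem sum_ite_numCols_comm (mu lam : YoungDiagram) (k l : ℕ) :
    ∑ nu ∈ between mu lam, (if numCols lam nu = k ∧ numCols nu mu = l then (1 : R) else 0) =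
      ∑ nu ∈ between mu lam, if numCols nu mu = k ∧ numCols lam nu = l then 1 else 0 := by
  have key := congrArg (fun p : Polynomial (Polynomial R) => (p.coeff l).coeff k)
    (sum_pow_numCols_mul_pow_numCols_comm (Polynomial.C Polynomial.X) Polynomial.X mu lam)
  simpa only [mul_comm (Polynomial.X ^ _), Polynomial.finsetSum_coeff,
    coeff_coeff_C_X_pow_mul_X_pow] using key

end Steps

section IncidenceAlgebra

instance : DecidableEq YoungDiagram := fun _ _ => decidable_of_iff _ YoungDiagram.ext_iff.symm

instance : DecidableLE YoungDiagram := fun _ _ => decidable_of_iff _ YoungDiagram.cells_subset_iff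

noncomputable instance : LocallyFiniteOrder YoungDiagram :=
  LocallyFiniteOrder.ofIcc YoungDiagram between fun _ _ _ => mem_between

variable (K : Type*) [CommRing K]

/-- The element of the incidence algebra of Young's lattice that is the indicator function of the
pairs `μ ⊂ λ` with `c(λ/μ) = k`. -/
noncomputable def stepElem (k : ℕ) : IncidenceAlgebra K YoungDiagram where
  toFun mu lam := if mu ≤ lam ∧ numCols lam mu = k then 1 else 0
  eq_zero_of_not_le' _ _ h := if_neg fun h' => h h'.1

variable {K}

theorem stepElem_apply {mu lam : YoungDiagram} (h : mu ≤ lam) (k : ℕ) :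
    stepElem K k mu lam = if numCols lam mu = k then 1 else 0 :=
  if_congr (and_iff_right h) rfl rfl

theorem numCols_eq_zero_iff {mu lam : YoungDiagram} (h : mu ≤ lam) :
    numCols lam mu = 0 ↔ mu = lam := by
  rw [numCols, Finset.card_eq_zero, Finset.image_eq_empty, skewCells,
    Finset.sdiff_eq_empty_iff_subset, YoungDiagram.cells_subset_iff]
  exact ⟨h.antisymm, ge_of_eq⟩

theorem stepElem_zero : stepElem K 0 = 1 := by
  ext mu lam h
  simp only [stepElem_apply h, numCols_eq_zero_iff h, IncidenceAlgebra.one_apply]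

theorem mul_stepElem_apply (f : IncidenceAlgebra K YoungDiagram) (k : ℕ) (mu lam : YoungDiagram) :
    (f * stepElem K k) mu lam =
      ∑ nu ∈ between mu lam, if numCols lam nu = k then f mu nu else 0 := by
  refine Finset.sum_congr rfl fun nu hnu => ?_
  rw [stepElem_apply (mem_between.mp hnu).2, mul_ite, mul_one, mul_zero]

theorem stepElem_mul_apply (f : IncidenceAlgebra K YoungDiagram) (k : ℕ) (mu lam : YoungDiagram) :
    (stepElem K k * f) mu lam =
      ∑ nu ∈ between mu lam, if numCols nu mu = k then f nu lam else 0 := by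
  refine Finset.sum_congr rfl fun nu hnu => ?_
  rw [stepElem_apply (mem_between.mp hnu).1, ite_mul, one_mul, zero_mul]

theorem commute_stepElem (k l : ℕ) : Commute (stepElem K k) (stepElem K l) := by
  ext mu lam _
  have left : (stepElem K k * stepElem K l) mu lam =
      ∑ nu ∈ between mu lam, if numCols nu mu = k ∧ numCols lam nu = l then 1 else 0 := by
    rw [stepElem_mul_apply]
    refine Finset.sum_congr rfl fun nu hnu => ?_
    rw [stepElem_apply (mem_between.mp hnu).2, ite_and]
  have right : (stepElem K l * stepElem K k) mu lam =
      ∑ nu ∈ between mu lam, if numCols lam nu = k ∧ numCols nu mu = l then 1 else 0 := by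
    rw [mul_stepElem_apply]
    refine Finset.sum_congr rfl fun nu hnu => ?_
    rw [stepElem_apply (mem_between.mp hnu).1, ite_and]
  rw [left, right, sum_ite_numCols_comm]

variable (K) in
/-- The product of the commuting elements `stepElem K (n i)` over the variables `i` occurring in
`n`. At `(μ, λ)` it counts the chains from `μ` to `λ` whose steps have the numbers of columns
prescribed by `n`. -/
noncomputable def stepProd (n : ℕ →₀ ℕ) : IncidenceAlgebra K YoungDiagram :=
  n.support.noncommProd (fun i => stepElem K (n i))
    (Set.pairwise_of_forall _ _ fun i j => commute_stepElem (n i) (n j))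

theorem stepProd_zero : stepProd K 0 = 1 := Finset.noncommProd_empty _ _

theorem commute_stepElem_stepProd (k : ℕ) (n : ℕ →₀ ℕ) : Commute (stepElem K k) (stepProd K n) :=
  Finset.noncommProd_commute _ _ _ _ fun _ _ => commute_stepElem _ _

theorem stepProd_add_single {n : ℕ →₀ ℕ} {i : ℕ} (hi : n i = 0) (k : ℕ) :
    stepProd K (n + Finsupp.single i k) = stepProd K n * stepElem K k := by
  rcases eq_or_ne k 0 with rfl | hk
  · rw [Finsupp.single_zero, add_zero, stepElem_zero, mul_one]
  · have hmem : i ∉ n.support := Finsupp.notMem_support_iff.mpr hi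
    rw [stepProd, Finset.noncommProd_congr (Finsupp.support_add_single hmem hk) fun _ _ => rfl]
    refine (Finset.noncommProd_cons' _ _ _ _ _).trans (congrArg₂ _ ?_ ?_)
    · refine Finset.noncommProd_congr rfl (fun j hj => ?_) _
      rw [Finsupp.add_apply, Finsupp.single_eq_of_ne (ne_of_mem_of_not_mem hj hmem), add_zero]
    · rw [Finsupp.add_apply, hi, zero_add, Finsupp.single_eq_same]

theorem stepProd_mapDomain {e : ℕ → ℕ} (he : Function.Injective e) (n : ℕ →₀ ℕ) :
    stepProd K (n.mapDomain e) = stepProd K n := by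
  induction n using Finsupp.induction with
  | zero => rw [Finsupp.mapDomain_zero]
  | single_add i k n hi _ ih =>
    rw [Finsupp.notMem_support_iff] at hi
    rw [add_comm, Finsupp.mapDomain_add, Finsupp.mapDomain_single, stepProd_add_single hi,
      stepProd_add_single (by rwa [Finsupp.mapDomain_apply he]), ih]

end IncidenceAlgebra

section Branching

theorem mem_skewCells {lam mu : YoungDiagram} {c : ℕ × ℕ} :
    c ∈ skewCells lam mu ↔ c ∈ lam ∧ c ∉ mu :=
  Finset.mem_sdiff

namespace RPP

variable {lam mu nu : YoungDiagram}

@[ext]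
theorem ext {T T' : RPP lam mu} (h : ∀ c, T.entry c = T'.entry c) : T = T' := by
  cases T
  cases T'
  congr
  exact funext h

theorem mem_entryCols {T : RPP lam mu} {p : ℕ × ℕ} :
    p ∈ T.entryCols ↔ ∃ c, T.entry c = p.1 ∧ c.1.2 = p.2 := by
  simp only [entryCols, Finset.mem_image, Finset.mem_univ, true_and, Prod.ext_iff]

theorem weight_ne_zero_iff {T : RPP lam mu} {i : ℕ} : T.weight i ≠ 0 ↔ ∃ c, T.entry c = i := by
  rw [weight_apply, Finset.card_ne_zero]
  constructor
  · rintro ⟨p, hp⟩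
    rw [Finset.mem_filter, mem_entryCols] at hp
    obtain ⟨⟨c, hc, -⟩, hi⟩ := hp
    exact ⟨c, hc.trans hi⟩
  · rintro ⟨c, rfl⟩
    exact ⟨(T.entry c, c.1.2), Finset.mem_filter.mpr ⟨mem_entryCols.mpr ⟨c, rfl, rfl⟩, rfl⟩⟩

theorem degree_weight (T : RPP lam mu) : T.weight.degree = T.entryCols.card := by
  simp only [weight, map_sum, Finsupp.degree_single, Finset.sum_const, smul_eq_mul, mul_one]

theorem degree_weight_le (T : RPP lam mu) : T.weight.degree ≤ lam.card := by
  refine T.degree_weight.trans_le (Finset.card_image_le.trans ?_)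
  rw [Finset.card_univ, Fintype.card_coe]
  exact Finset.card_le_card Finset.sdiff_subset

instance finite_weight_eq (n : ℕ →₀ ℕ) : Finite {T : RPP lam mu // T.weight = n} := by
  have entry_mem (T : {T : RPP lam mu // T.weight = n}) (c) : T.1.entry c ∈ n.support := by
    rw [Finsupp.mem_support_iff, ← DFunLike.congr_fun T.2, weight_ne_zero_iff]
    exact ⟨c, rfl⟩
  refine Finite.of_injective
    (fun T c => (⟨T.1.entry c, entry_mem T c⟩ : n.support)) fun T T' h => ?_
  exact Subtype.ext (RPP.ext fun c => congrArg Subtype.val (congrFun h c))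

/-- The restriction of a reverse plane partition of shape `λ/μ` to the boxes of `ν/μ`, where
`ν ⊂ λ`. -/
@[simps]
def restrict (h : nu ≤ lam) (T : RPP lam mu) : RPP nu mu where
  entry c := T.entry ⟨c.1, mem_skewCells.mpr
    ⟨h (mem_skewCells.mp c.2).1, (mem_skewCells.mp c.2).2⟩⟩
  row_weak _ _ hrow hcol := T.row_weak _ _ hrow hcol
  col_weak _ _ hcol hrow := T.col_weak _ _ hcol hrow

/-- The extension of a reverse plane partition of shape `ν/μ` with entries below `M` to one of
shape `λ/μ` by the entry `M` in all boxes of `λ` outside `ν`. -/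
@[simps]
def extend (T : RPP nu mu) (M : ℕ) (hM : ∀ c, T.entry c < M) : RPP lam mu where
  entry c := if h : c.1 ∈ nu then
    T.entry ⟨c.1, mem_skewCells.mpr ⟨h, (mem_skewCells.mp c.2).2⟩⟩ else M
  row_weak c d hrow hcol := by
    split_ifs with hc hd hd
    · exact T.row_weak _ _ hrow hcol
    · exact (hM _).le
    · exact absurd (nu.up_left_mem hrow.le hcol hd) hc
    · exact le_rfl
  col_weak c d hcol hrow := by
    split_ifs with hc hd hd
    · exact T.col_weak _ _ hcol hrow
    · exact (hM _).le
    · exact absurd (nu.up_left_mem hrow hcol.le hd) hc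
    · exact le_rfl

/-- The diagram formed by `μ` and the boxes of a reverse plane partition of shape `λ/μ` whose
entries are less than `M`. -/
def lower (T : RPP lam mu) (M : ℕ) : YoungDiagram where
  cells := lam.cells.filter fun c => ∀ h : c ∈ skewCells lam mu, T.entry ⟨c, h⟩ < M
  isLowerSet := by
    rintro ⟨i, j⟩ ⟨i', j'⟩ ⟨hi : i' ≤ i, hj : j' ≤ j⟩ hc
    rw [Finset.mem_coe, Finset.mem_filter, YoungDiagram.mem_cells] at hc ⊢
    refine ⟨lam.up_left_mem hi hj hc.1, fun h => ?_⟩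
    have not_mem := (mem_skewCells.mp h).2
    have corner : (i', j) ∈ skewCells lam mu := mem_skewCells.mpr
      ⟨lam.up_left_mem hi le_rfl hc.1, fun hmu => not_mem (mu.up_left_mem le_rfl hj hmu)⟩
    have last : (i, j) ∈ skewCells lam mu := mem_skewCells.mpr
      ⟨hc.1, fun hmu => not_mem (mu.up_left_mem hi hj hmu)⟩
    calc T.entry ⟨(i', j'), h⟩ ≤ T.entry ⟨(i', j), corner⟩ := T.row_weak _ _ rfl hj
      _ ≤ T.entry ⟨(i, j), last⟩ := T.col_weak _ _ rfl hi
      _ < M := hc.2 last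

theorem mem_lower {T : RPP lam mu} {M : ℕ} {c : ℕ × ℕ} :
    c ∈ T.lower M ↔ c ∈ lam ∧ ∀ h : c ∈ skewCells lam mu, T.entry ⟨c, h⟩ < M := by
  rw [← YoungDiagram.mem_cells, lower, Finset.mem_filter, YoungDiagram.mem_cells]

theorem lower_le (T : RPP lam mu) (M : ℕ) : T.lower M ≤ lam := fun _ hc => (mem_lower.mp hc).1

theorem le_lower (h : mu ≤ lam) (T : RPP lam mu) (M : ℕ) : mu ≤ T.lower M := fun _ hc =>
  mem_lower.mpr ⟨h hc, fun hskew => absurd hc (mem_skewCells.mp hskew).2⟩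

theorem entry_restrict_lower_lt (T : RPP lam mu) (M : ℕ) (c) :
    (T.restrict (T.lower_le M)).entry c < M := by
  rw [restrict_entry]
  exact (mem_lower.mp (mem_skewCells.mp c.2).1).2 _

theorem restrict_extend (h : nu ≤ lam) {T : RPP nu mu} {M : ℕ} (hM : ∀ c, T.entry c < M) :
    (T.extend M hM : RPP lam mu).restrict h = T :=
  RPP.ext fun c => by rw [restrict_entry, extend_entry, dif_pos (mem_skewCells.mp c.2).1]

theorem lower_extend (hmu : mu ≤ nu) (hlam : nu ≤ lam) {T : RPP nu mu} {M : ℕ}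
    (hM : ∀ c, T.entry c < M) : (T.extend M hM : RPP lam mu).lower M = nu := by
  refine SetLike.ext fun c => mem_lower.trans
    ⟨fun ⟨hc, hlt⟩ => ?_, fun hc => ⟨hlam hc, fun _ => ?_⟩⟩
  · by_contra hnot
    have := hlt (mem_skewCells.mpr ⟨hc, fun h => hnot (hmu h)⟩)
    rw [extend_entry, dif_neg hnot] at this
    exact this.false
  · rw [extend_entry, dif_pos hc]
    exact hM _

theorem extend_restrict_lower {T : RPP lam mu} {M : ℕ} (hM : ∀ c, T.entry c ≤ M) :
    (T.restrict (T.lower_le M)).extend M (T.entry_restrict_lower_lt M) = T := by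
  ext c
  rw [extend_entry]
  split_ifs with h
  · rfl
  · have hle : ¬T.entry c < M := fun hlt =>
      h (mem_lower.mpr ⟨(mem_skewCells.mp c.2).1, fun _ => hlt⟩)
    exact le_antisymm (not_lt.mp hle) (hM c)

theorem entryCols_extend (hmu : mu ≤ nu) (hlam : nu ≤ lam) {T : RPP nu mu} {M : ℕ}
    (hM : ∀ c, T.entry c < M) : (T.extend M hM : RPP lam mu).entryCols =
      T.entryCols ∪ ((skewCells lam nu).image Prod.snd).image (Prod.mk M) := by
  ext ⟨i, j⟩
  simp only [Finset.mem_union, mem_entryCols, Finset.mem_image, Prod.mk.injEq, extend_entry]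
  constructor
  · rintro ⟨c, hc, hj⟩
    have hskew := mem_skewCells.mp c.2
    split_ifs at hc with h
    · exact .inl ⟨⟨c.1, mem_skewCells.mpr ⟨h, hskew.2⟩⟩, hc, hj⟩
    · exact .inr ⟨j, ⟨c.1, mem_skewCells.mpr ⟨hskew.1, h⟩, hj⟩, hc, rfl⟩
  · rintro (⟨c, hc, hj⟩ | ⟨_, ⟨c, hskew, hj⟩, hi, rfl⟩)
    · obtain ⟨hnu, hnot⟩ := mem_skewCells.mp c.2
      exact ⟨⟨c.1, mem_skewCells.mpr ⟨hlam hnu, hnot⟩⟩, (dif_pos hnu).trans hc, hj⟩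
    · obtain ⟨hmem, hnot⟩ := mem_skewCells.mp hskew
      exact ⟨⟨c, mem_skewCells.mpr ⟨hmem, fun h => hnot (hmu h)⟩⟩, (dif_neg hnot).trans hi, hj⟩

theorem weight_extend (hmu : mu ≤ nu) (hlam : nu ≤ lam) {T : RPP nu mu} {M : ℕ}
    (hM : ∀ c, T.entry c < M) :
    (T.extend M hM : RPP lam mu).weight = T.weight + Finsupp.single M (numCols lam nu) := by
  have disjoint : Disjoint T.entryCols
      (((skewCells lam nu).image Prod.snd).image (Prod.mk M)) := by
    rw [Finset.disjoint_right]
    intro p hp hT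
    obtain ⟨j, -, rfl⟩ := Finset.mem_image.mp hp
    obtain ⟨c, hc, -⟩ := mem_entryCols.mp hT
    exact (hM c).ne hc
  rw [weight, entryCols_extend hmu hlam, Finset.sum_union disjoint,
    Finset.sum_image (Prod.mk_right_injective M).injOn, Finset.sum_const (Finsupp.single M 1),
    Finsupp.smul_single, smul_eq_mul, mul_one]
  rfl

theorem entry_lt_of_weight_eq {T : RPP lam mu} {n : ℕ →₀ ℕ} {M : ℕ}
    (hn : ∀ i ∈ n.support, i < M) (hT : T.weight = n) (c) : T.entry c < M := by
  apply hn
  rw [Finsupp.mem_support_iff, ← hT, weight_ne_zero_iff]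
  exact ⟨c, rfl⟩

theorem entry_le_of_weight_eq_add_single {T : RPP lam mu} {n : ℕ →₀ ℕ} {M k : ℕ}
    (hn : ∀ i ∈ n.support, i < M) (hT : T.weight = n + Finsupp.single M k) (c) :
    T.entry c ≤ M := by
  refine Nat.lt_succ_iff.mp (entry_lt_of_weight_eq (fun i hi => ?_) hT c)
  rcases Finset.mem_union.mp (Finsupp.support_add hi) with h | h
  · exact (hn i h).trans M.lt_succ_self
  · rw [Finset.mem_singleton.mp (Finsupp.support_single_subset h)]
    exact M.lt_succ_self

theorem weight_restrict_lower (h : mu ≤ lam) {T : RPP lam mu} {n : ℕ →₀ ℕ} {M k : ℕ}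
    (hn : ∀ i ∈ n.support, i < M) (hT : T.weight = n + Finsupp.single M k) :
    (T.restrict (T.lower_le M)).weight = n ∧ numCols lam (T.lower M) = k := by
  have weight_eq : n + Finsupp.single M k =
      (T.restrict (T.lower_le M)).weight + Finsupp.single M (numCols lam (T.lower M)) := by
    rw [← weight_extend (T.le_lower h M) (T.lower_le M) (T.entry_restrict_lower_lt M),
      extend_restrict_lower (entry_le_of_weight_eq_add_single hn hT), hT]
  have n_apply : n M = 0 := Finsupp.notMem_support_iff.mp fun h => (hn M h).false
  have restrict_apply : (T.restrict (T.lower_le M)).weight M = 0 := by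
    by_contra hne
    obtain ⟨c, hc⟩ := weight_ne_zero_iff.mp hne
    exact (T.entry_restrict_lower_lt M c).ne hc
  have cols := DFunLike.congr_fun weight_eq M
  rw [Finsupp.add_apply, Finsupp.add_apply, n_apply, restrict_apply, zero_add, zero_add,
    Finsupp.single_eq_same, Finsupp.single_eq_same] at cols
  rw [← cols] at weight_eq
  exact ⟨(add_right_cancel weight_eq).symm, cols.symm⟩

theorem card_weight_eq_add_single (h : mu ≤ lam) {n : ℕ →₀ ℕ} {M : ℕ} (k : ℕ)
    (hn : ∀ i ∈ n.support, i < M) :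
    Nat.card {T : RPP lam mu // T.weight = n + Finsupp.single M k} =
      ∑ nu ∈ between mu lam with numCols lam nu = k, Nat.card {T : RPP nu mu // T.weight = n} := by
  have mem (nu : {nu // nu ∈ (between mu lam).filter (numCols lam · = k)}) :
      (mu ≤ nu.1 ∧ nu.1 ≤ lam) ∧ numCols lam nu.1 = k := by
    rw [← mem_between]
    exact Finset.mem_filter.mp nu.2
  have lt {nu : YoungDiagram} (T : {T : RPP nu mu // T.weight = n}) (c) : T.1.entry c < M :=
    entry_lt_of_weight_eq hn T.2 c
  rw [← Finset.sum_coe_sort, ← Nat.card_sigma, eq_comm]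
  refine Nat.card_congr (Equiv.ofBijective (fun p => ⟨p.2.1.extend M (lt p.2), ?_⟩) ⟨?_, ?_⟩)
  · rw [weight_extend (mem p.1).1.1 (mem p.1).1.2, p.2.2, (mem p.1).2]
  · rintro ⟨nu, T⟩ ⟨nu', T'⟩ heq
    have heq : T.1.extend M (lt T) = T'.1.extend M (lt T') := congrArg Subtype.val heq
    obtain rfl : nu = nu' := by
      rw [Subtype.ext_iff, ← lower_extend (mem nu).1.1 (mem nu).1.2 (lt T), heq,
        lower_extend (mem nu').1.1 (mem nu').1.2 (lt T')]
    congr 1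
    rw [Subtype.ext_iff, ← restrict_extend (mem nu).1.2 (lt T), heq,
      restrict_extend (mem nu).1.2 (lt T')]
  · rintro ⟨T, hT⟩
    obtain ⟨weight_eq, cols⟩ := weight_restrict_lower h hn hT
    refine ⟨⟨⟨T.lower M, Finset.mem_filter.mpr
      ⟨mem_between.mpr ⟨T.le_lower h M, T.lower_le M⟩, cols⟩⟩, ⟨_, weight_eq⟩⟩, Subtype.ext ?_⟩
    exact extend_restrict_lower (entry_le_of_weight_eq_add_single hn hT)

theorem card_weight_eq_zero (h : mu ≤ lam) :
    Nat.card {T : RPP lam mu // T.weight = 0} = if mu = lam then 1 else 0 := by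
  split_ifs with heq
  · subst heq
    have : IsEmpty {c // c ∈ skewCells mu mu} :=
      ⟨fun c => (mem_skewCells.mp c.2).2 (mem_skewCells.mp c.2).1⟩
    have weight_eq (T : RPP mu mu) : T.weight = 0 := by
      ext i
      by_contra hi
      obtain ⟨c, -⟩ := weight_ne_zero_iff.mp hi
      exact isEmptyElim c
    rw [Nat.card_eq_one_iff_unique]
    exact ⟨⟨fun _ _ => Subtype.ext (RPP.ext isEmptyElim)⟩,
      ⟨⟨⟨isEmptyElim, isEmptyElim, isEmptyElim⟩, weight_eq _⟩⟩⟩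
  · rw [Nat.card_eq_zero]
    refine .inl ⟨fun T => heq (le_antisymm h fun c hlam => ?_)⟩
    by_contra hmu
    refine (weight_ne_zero_iff (T := T.1)).mpr ⟨⟨c, mem_skewCells.mpr ⟨hlam, hmu⟩⟩, rfl⟩ ?_
    rw [T.2, Finsupp.zero_apply]

end RPP

theorem coeff_dualGroth_eq_stepProd (K : Type*) [CommRing K] {lam mu : YoungDiagram}
    (h : mu ≤ lam) (n : ℕ →₀ ℕ) :
    MvPowerSeries.coeff n (dualGroth K lam mu) = stepProd K n mu lam := by
  induction n using Finsupp.induction_on_max₂ generalizing lam with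
  | zero =>
    rw [stepProd_zero, IncidenceAlgebra.one_apply]
    refine (congrArg Nat.cast (RPP.card_weight_eq_zero h)).trans ?_
    rw [Nat.cast_ite, Nat.cast_one, Nat.cast_zero]
  | add_single M k n hn _ ih =>
    rw [stepProd_add_single (Finsupp.notMem_support_iff.mp fun hM => (hn M hM).false),
      mul_stepElem_apply, ← Finset.sum_filter]
    refine (congrArg Nat.cast (RPP.card_weight_eq_add_single h k hn)).trans ?_
    rw [Nat.cast_sum]
    refine Finset.sum_congr rfl fun nu hnu => ih ?_
    exact (mem_between.mp (Finset.mem_filter.mp hnu).1).1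

end Branching

section Symmetry

variable {K : Type*} [CommRing K]

theorem coeff_mapDomain_rename_equiv {α β : Type*} (e : α ≃ β) (f : MvPowerSeries α K)
    (n : α →₀ ℕ) :
    MvPowerSeries.coeff (n.mapDomain e) (MvPowerSeries.rename (R := K) e f) =
      MvPowerSeries.coeff n f := by
  rw [← MvPowerSeries.coeff_embDomain_rename e.toEmbedding, Finsupp.embDomain_eq_mapDomain]
  rfl

theorem mem_SymSeries_iff {f : MvPowerSeries ℕ K} :
    f ∈ SymSeries K ↔ ∀ (σ : Equiv.Perm ℕ) (n : ℕ →₀ ℕ),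
      MvPowerSeries.coeff (n.mapDomain σ) f = MvPowerSeries.coeff n f := by
  rw [SymSeries, Algebra.mem_iInf]
  refine forall_congr' fun σ => ?_
  rw [AlgHom.mem_equalizer, AlgHom.id_apply, MvPowerSeries.ext_iff]
  refine (Finsupp.mapDomain_surjective σ.surjective).forall.trans (forall_congr' fun n => ?_)
  rw [coeff_mapDomain_rename_equiv, eq_comm]

theorem dualGroth_mem_Sym {lam mu : YoungDiagram} (h : mu ≤ lam) : dualGroth K lam mu ∈ Sym K := by
  refine ⟨mem_SymSeries_iff.mpr fun σ n => ?_, lam.card, fun n hn => ?_⟩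
  · rw [coeff_dualGroth_eq_stepProd K h, coeff_dualGroth_eq_stepProd K h,
      stepProd_mapDomain σ.injective]
  · have : IsEmpty {T : RPP lam mu // T.weight = n} :=
      ⟨fun T => hn.not_ge (T.2 ▸ T.1.degree_weight_le)⟩
    exact (congrArg Nat.cast Nat.card_of_isEmpty).trans Nat.cast_zero

end Symmetry

section Semistandard

variable {lam : YoungDiagram}

theorem content_apply (T : SemistandardYoungTableau lam) (i : ℕ) :
    content T i = {c ∈ lam.cells | T c.1 c.2 = i}.card := by
  rw [content, Finsupp.finsetSum_apply, Finset.card_filter]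
  exact Finset.sum_congr rfl fun _ _ => Finsupp.single_apply

theorem degree_content (T : SemistandardYoungTableau lam) : (content T).degree = lam.card := by
  simp only [content, map_sum, Finsupp.degree_single, ← Finset.card_eq_sum_ones]

theorem tableau_eq_iff_of_mem {T : SemistandardYoungTableau lam} {i i' j : ℕ} (h : (i, j) ∈ lam)
    (h' : (i', j) ∈ lam) : T i j = T i' j ↔ i = i' := by
  refine ⟨fun heq => ?_, fun heq => heq ▸ rfl⟩
  rcases lt_trichotomy i i' with hlt | hi | hlt
  · exact absurd heq (T.col_strict hlt h').ne
  · exact hi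
  · exact absurd heq (T.col_strict hlt h).ne'

/-- A semistandard tableau of shape `λ`, considered as a reverse plane partition. -/
@[simps]
def toRPP (T : SemistandardYoungTableau lam) : RPP lam ⊥ where
  entry c := T c.1.1 c.1.2
  row_weak c d hrow hcol := by rw [hrow]; exact T.row_weak_of_le hcol (mem_skewCells.mp d.2).1
  col_weak c d hcol hrow := by rw [hcol]; exact T.col_weak hrow (mem_skewCells.mp d.2).1

theorem skewCells_bot (lam : YoungDiagram) : skewCells lam ⊥ = lam.cells := by
  rw [skewCells, YoungDiagram.cells_bot, Finset.sdiff_empty]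

theorem weight_toRPP (T : SemistandardYoungTableau lam) : (toRPP T).weight = content T := by
  have entryCols_eq :
      (toRPP T).entryCols = lam.cells.image fun c => (T c.1 c.2, c.2) := by
    ext p
    simp only [RPP.mem_entryCols, toRPP_entry, Finset.mem_image, Prod.ext_iff, Subtype.exists,
      skewCells_bot, exists_prop]
  rw [RPP.weight, entryCols_eq, Finset.sum_image, content]
  rintro ⟨i, j⟩ hc ⟨i', j'⟩ hc' heq
  obtain ⟨hentry, rfl⟩ := Prod.mk.inj heq
  rw [(tableau_eq_iff_of_mem hc hc').mp hentry]

theorem toRPP_injective : Function.Injective (toRPP (lam := lam)) := by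
  intro T T' h
  ext i j
  by_cases hc : (i, j) ∈ lam
  · exact congrFun (congrArg RPP.entry h)
      ⟨(i, j), mem_skewCells.mpr ⟨hc, YoungDiagram.notMem_bot _⟩⟩
  · rw [T.zeros hc, T'.zeros hc]

theorem entry_lt_entry_of_degree_weight_eq_card {T : RPP lam ⊥} (hT : T.weight.degree = lam.card)
    {c d : {c // c ∈ skewCells lam ⊥}} (hcol : c.1.2 = d.1.2) (hrow : c.1.1 < d.1.1) :
    T.entry c < T.entry d := by
  refine lt_of_le_of_ne (T.col_weak c d hcol hrow.le) fun heq => hrow.ne ?_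
  have card_univ : (Finset.univ : Finset {c // c ∈ skewCells lam ⊥}).card = lam.card := by
    rw [Finset.card_univ, Fintype.card_coe, skewCells_bot]
  have injOn := Finset.card_image_iff.mp (T.degree_weight.symm.trans (hT.trans card_univ.symm))
  rw [injOn (Finset.mem_coe.mpr (Finset.mem_univ c)) (Finset.mem_coe.mpr (Finset.mem_univ d))
    (Prod.ext heq hcol)]

theorem exists_toRPP_eq {T : RPP lam ⊥} (hT : T.weight.degree = lam.card) :
    ∃ S : SemistandardYoungTableau lam, toRPP S = T := by
  have skew {i j : ℕ} (h : (i, j) ∈ lam) : (i, j) ∈ skewCells lam ⊥ :=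
    mem_skewCells.mpr ⟨h, YoungDiagram.notMem_bot _⟩
  refine ⟨{ entry := fun i j => if h : (i, j) ∈ lam then T.entry ⟨(i, j), skew h⟩ else 0
            row_weak' := fun hj h => ?_
            col_strict' := fun hi h => ?_
            zeros' := fun h => dif_neg h }, RPP.ext fun c => dif_pos (mem_skewCells.mp c.2).1⟩
  · rw [dif_pos h, dif_pos (lam.up_left_mem le_rfl hj.le h)]
    exact T.row_weak _ _ rfl hj.le
  · rw [dif_pos h, dif_pos (lam.up_left_mem hi.le le_rfl h)]
    exact entry_lt_entry_of_degree_weight_eq_card hT rfl hi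

variable (K : Type*) [CommRing K]

theorem coeff_schur_of_degree_ne_card {n : ℕ →₀ ℕ} (h : n.degree ≠ lam.card) :
    MvPowerSeries.coeff n (schur K lam) = 0 := by
  have : IsEmpty {T : SemistandardYoungTableau lam // content T = n} :=
    ⟨fun T => h (T.2 ▸ degree_content T.1)⟩
  exact (congrArg Nat.cast Nat.card_of_isEmpty).trans Nat.cast_zero

theorem coeff_schur_of_degree_eq_card {n : ℕ →₀ ℕ} (h : n.degree = lam.card) :
    MvPowerSeries.coeff n (schur K lam) = MvPowerSeries.coeff n (dualGroth K lam ⊥) := by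
  refine congrArg Nat.cast (Nat.card_congr (Equiv.ofBijective
    (Subtype.map toRPP fun T hT => (weight_toRPP T).trans hT)
    ⟨Subtype.map_injective _ toRPP_injective, fun T => ?_⟩))
  obtain ⟨S, hS⟩ := exists_toRPP_eq ((congrArg Finsupp.degree T.2).trans h)
  exact ⟨⟨S, (weight_toRPP S).symm.trans ((congrArg RPP.weight hS).trans T.2)⟩, Subtype.ext hS⟩

theorem schur_mem_Sym (lam : YoungDiagram) : schur K lam ∈ Sym K := by
  refine ⟨mem_SymSeries_iff.mpr fun σ n => ?_, lam.card,
    fun n hn => coeff_schur_of_degree_ne_card K hn.ne'⟩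
  have degree_eq := Finsupp.degree_mapDomain σ n
  by_cases h : n.degree = lam.card
  · rw [coeff_schur_of_degree_eq_card K h, coeff_schur_of_degree_eq_card K (degree_eq.trans h),
      mem_SymSeries_iff.mp (dualGroth_mem_Sym bot_le).1]
  · rw [coeff_schur_of_degree_ne_card K h, coeff_schur_of_degree_ne_card K (degree_eq ▸ h)]

end Semistandard

section PartitionMonomials

/-- The sum of the row indices of the boxes of a diagram, usually denoted by `n(λ)`. -/
def rowIndexSum (lam : YoungDiagram) : ℕ := ∑ c ∈ lam.cells, c.1

/-- The exponent of the monomial `x^λ`, whose entries are the row lengths of the diagram `λ`; it is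
the content of the tableau of shape `λ` with entry `i` throughout row `i`. -/
noncomputable def rowContent (lam : YoungDiagram) : ℕ →₀ ℕ :=
  content (SemistandardYoungTableau.highestWeight lam)

theorem rowContent_apply (lam : YoungDiagram) (i : ℕ) : rowContent lam i = lam.rowLen i := by
  rw [rowContent, content_apply, YoungDiagram.rowLen_eq_card]
  congr 1
  ext c
  rw [Finset.mem_filter, YoungDiagram.mem_cells, YoungDiagram.mem_row_iff,
    SemistandardYoungTableau.highestWeight_apply]
  exact and_congr_right fun hc => by rw [if_pos hc]

theorem rowContent_injective : Function.Injective rowContent := by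
  intro lam mu h
  ext ⟨i, j⟩
  rw [YoungDiagram.mem_cells, YoungDiagram.mem_cells, YoungDiagram.mem_iff_lt_rowLen,
    YoungDiagram.mem_iff_lt_rowLen, ← rowContent_apply, ← rowContent_apply, h]

theorem exists_rowContent_eq {n : ℕ →₀ ℕ} (hn : Antitone n) : ∃ lam, rowContent lam = n := by
  let lam : YoungDiagram :=
    { cells := n.support.biUnion fun i => {i} ×ˢ Finset.range (n i)
      isLowerSet := by
        rintro ⟨i, j⟩ ⟨i', j'⟩ ⟨hi : i' ≤ i, hj : j' ≤ j⟩ hc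
        simp only [Finset.mem_coe, Finset.mem_biUnion, Finsupp.mem_support_iff,
          Finset.mem_product, Finset.mem_singleton, Finset.mem_range] at hc ⊢
        obtain ⟨_, _, rfl, hlt⟩ := hc
        have hlt' := hj.trans_lt (hlt.trans_le (hn hi))
        exact ⟨i', hlt'.ne_bot, rfl, hlt'⟩ }
  have mem_iff (i j : ℕ) : (i, j) ∈ lam ↔ j < n i := by
    rw [← YoungDiagram.mem_cells]
    simp only [lam, Finset.mem_biUnion, Finsupp.mem_support_iff, Finset.mem_product,
      Finset.mem_singleton, Finset.mem_range]
    exact ⟨fun ⟨_, _, hi, hj⟩ => hi ▸ hj, fun hj => ⟨i, hj.ne_bot, rfl, hj⟩⟩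
  refine ⟨lam, Finsupp.ext fun i => ?_⟩
  simp only [YoungDiagram.mem_iff_lt_rowLen] at mem_iff
  rw [rowContent_apply]
  exact eq_of_forall_lt_iff (mem_iff i)

theorem weight_content {lam : YoungDiagram} (T : SemistandardYoungTableau lam) :
    Finsupp.weight (id : ℕ → ℕ) (content T) = ∑ c ∈ lam.cells, T c.1 c.2 := by
  simp only [content, map_sum, Finsupp.weight_single, one_smul, id]

theorem row_le_entry {lam : YoungDiagram} (T : SemistandardYoungTableau lam) {i j : ℕ}
    (h : (i, j) ∈ lam) : i ≤ T i j := by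
  induction i with
  | zero => exact Nat.zero_le _
  | succ i ih =>
    exact (ih (lam.up_left_mem i.le_succ le_rfl h)).trans_lt (T.col_strict i.lt_succ_self h)

theorem weight_rowContent (lam : YoungDiagram) :
    Finsupp.weight (id : ℕ → ℕ) (rowContent lam) = rowIndexSum lam := by
  rw [rowContent, weight_content]
  refine Finset.sum_congr rfl fun c hc => ?_
  rw [SemistandardYoungTableau.highestWeight_apply, if_pos ((YoungDiagram.mem_cells _).mp hc)]

theorem eq_highestWeight_of_weight_content_le {lam : YoungDiagram}
    {T : SemistandardYoungTableau lam}
    (hT : Finsupp.weight (id : ℕ → ℕ) (content T) ≤ rowIndexSum lam) :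
    T = SemistandardYoungTableau.highestWeight lam := by
  have row_le (c) (hc : c ∈ lam.cells) : c.1 ≤ T c.1 c.2 :=
    row_le_entry T ((YoungDiagram.mem_cells _).mp hc)
  rw [weight_content] at hT
  have row_eq := (Finset.sum_eq_sum_iff_of_le row_le).mp ((Finset.sum_le_sum row_le).antisymm hT)
  ext i j
  rw [SemistandardYoungTableau.highestWeight_apply]
  split_ifs with hc
  · exact (row_eq (i, j) ((YoungDiagram.mem_cells _).mpr hc)).symm
  · exact T.zeros hc

variable {K : Type*} [CommRing K]

theorem coeff_rowContent_schur_self (lam : YoungDiagram) :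
    MvPowerSeries.coeff (rowContent lam) (schur K lam) = 1 := by
  have unique (T : {T : SemistandardYoungTableau lam // content T = rowContent lam}) :
      T = ⟨SemistandardYoungTableau.highestWeight lam, rfl⟩ :=
    Subtype.ext (eq_highestWeight_of_weight_content_le
      (T.2.symm ▸ (weight_rowContent lam).le))
  have : Unique {T : SemistandardYoungTableau lam // content T = rowContent lam} := ⟨⟨_⟩, unique⟩
  exact (congrArg Nat.cast Nat.card_unique).trans Nat.cast_one

theorem coeff_rowContent_schur_eq_zero {lam mu : YoungDiagram} (hne : lam ≠ mu)
    (h : rowIndexSum mu ≤ rowIndexSum lam) :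
    MvPowerSeries.coeff (rowContent mu) (schur K lam) = 0 := by
  have : IsEmpty {T : SemistandardYoungTableau lam // content T = rowContent mu} := by
    refine ⟨fun ⟨T, hT⟩ => hne (rowContent_injective ?_)⟩
    have highest := eq_highestWeight_of_weight_content_le (T := T)
      (hT ▸ (weight_rowContent mu).trans_le h)
    rw [rowContent, ← highest, hT]
  exact (congrArg Nat.cast Nat.card_of_isEmpty).trans Nat.cast_zero

theorem weight_mapDomain_swap_lt {n : ℕ →₀ ℕ} {i : ℕ} (h : n i < n (i + 1)) :
    Finsupp.weight (id : ℕ → ℕ) (n.mapDomain (Equiv.swap i (i + 1))) <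
      Finsupp.weight (id : ℕ → ℕ) n := by
  set m := (n.erase i).erase (i + 1) with hm
  have decomposition : n = m + Finsupp.single (i + 1) (n (i + 1)) + Finsupp.single i (n i) := by
    rw [hm, ← Finsupp.erase_ne (f := n) i.succ_ne_self, Finsupp.erase_add_single,
      Finsupp.erase_add_single]
  have fixed : m.mapDomain (Equiv.swap i (i + 1)) = m := by
    conv_rhs => rw [← Finsupp.mapDomain_id (v := m)]
    refine Finsupp.mapDomain_congr fun j hj => Equiv.swap_apply_of_ne_of_ne ?_ ?_ <;>
      · rintro rfl
        simp [hm] at hj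
  rw [decomposition, Finsupp.mapDomain_add, Finsupp.mapDomain_add, fixed,
    Finsupp.mapDomain_single, Finsupp.mapDomain_single, Equiv.swap_apply_left,
    Equiv.swap_apply_right]
  simp only [map_add, Finsupp.weight_single, id, smul_eq_mul]
  linarith

theorem eq_zero_of_forall_coeff_rowContent {f : MvPowerSeries ℕ K} (hf : f ∈ SymSeries K)
    (h : ∀ lam, MvPowerSeries.coeff (rowContent lam) f = 0) : f = 0 := by
  ext n
  rw [map_zero]
  induction hw : Finsupp.weight (id : ℕ → ℕ) n using Nat.strong_induction_on generalizing n with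
  | _ w ih =>
    by_cases hn : ∀ i, n (i + 1) ≤ n i
    · obtain ⟨lam, rfl⟩ := exists_rowContent_eq (antitone_nat_of_succ_le hn)
      exact h lam
    · push Not at hn
      obtain ⟨i, hi⟩ := hn
      rw [← mem_SymSeries_iff.mp hf (Equiv.swap i (i + 1)) n]
      exact ih _ (hw ▸ weight_mapDomain_swap_lt hi) _ rfl

end PartitionMonomials

section SchurExpansion

theorem finite_card_eq (d : ℕ) : {lam : YoungDiagram | lam.card = d}.Finite := by
  refine Set.Finite.of_finite_image (f := YoungDiagram.cells)
    ((Finset.range d ×ˢ Finset.range d).powerset.finite_toSet.subset ?_)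
    fun _ _ _ _ => YoungDiagram.ext
  rintro _ ⟨lam, rfl, rfl⟩
  refine Finset.mem_coe.mpr (Finset.mem_powerset.mpr fun ⟨i, j⟩ hc => ?_)
  rw [YoungDiagram.mem_cells] at hc
  have row_lt := YoungDiagram.mem_iff_lt_colLen.mp hc
  have col_lt := YoungDiagram.mem_iff_lt_rowLen.mp hc
  rw [YoungDiagram.colLen_eq_card] at row_lt
  rw [YoungDiagram.rowLen_eq_card] at col_lt
  exact Finset.mem_product.mpr
    ⟨Finset.mem_range.mpr (row_lt.trans_le (Finset.card_le_card (Finset.filter_subset _ _))),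
      Finset.mem_range.mpr (col_lt.trans_le (Finset.card_le_card (Finset.filter_subset _ _)))⟩

/-- The finite set of the partitions of `d`. -/
noncomputable def ofCard (d : ℕ) : Finset YoungDiagram := (finite_card_eq d).toFinset

theorem mem_ofCard {d : ℕ} {lam : YoungDiagram} : lam ∈ ofCard d ↔ lam.card = d :=
  Set.Finite.mem_toFinset _

variable {K : Type*} [CommRing K]

theorem coeff_schurSum (A : YoungDiagram → K) (n : ℕ →₀ ℕ) :
    MvPowerSeries.coeff n (schurSum A) =
      ∑ lam ∈ ofCard n.degree, A lam * MvPowerSeries.coeff n (schur K lam) := by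
  refine finsum_eq_sum_of_support_subset _ fun lam h => mem_ofCard.mpr ?_
  by_contra hne
  exact h (by simp only [coeff_schur_of_degree_ne_card K (Ne.symm hne), mul_zero])

theorem schurSum_mem_SymSeries (A : YoungDiagram → K) : schurSum A ∈ SymSeries K := by
  refine mem_SymSeries_iff.mpr fun σ n => ?_
  simp only [coeff_schurSum, Finsupp.degree_mapDomain,
    mem_SymSeries_iff.mp (schur_mem_Sym K _).1]

/-- The map `A ↦ ∑_λ A_λ s_λ`, with values in the symmetric power series, as a linear map. -/
@[simps]
noncomputable def schurSumLin : (YoungDiagram → K) →ₗ[K] SymSeries K where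
  toFun A := ⟨schurSum A, schurSum_mem_SymSeries A⟩
  map_add' A B := Subtype.ext <| MvPowerSeries.ext fun n => by
    simp only [Subalgebra.coe_add, map_add, coeff_schurSum, Pi.add_apply, add_mul,
      Finset.sum_add_distrib]
  map_smul' r A := Subtype.ext <| MvPowerSeries.ext fun n => by
    simp only [Subalgebra.coe_smul, map_smul, coeff_schurSum, Pi.smul_apply, smul_eq_mul,
      Finset.mul_sum, mul_assoc, RingHom.id_apply]

/-- The coefficients of a symmetric power series at the monomials `x^λ`, as a linear map. -/
@[simps]
noncomputable def rowCoeffLin : SymSeries K →ₗ[K] YoungDiagram → K where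
  toFun f lam := MvPowerSeries.coeff (rowContent lam) (f : MvPowerSeries ℕ K)
  map_add' f g := funext fun _ => map_add _ (f : MvPowerSeries ℕ K) g
  map_smul' r f := funext fun _ => map_smul _ r (f : MvPowerSeries ℕ K)

theorem rowCoeffLin_injective : Function.Injective (rowCoeffLin (K := K)) :=
  (injective_iff_map_eq_zero _).mpr fun f hf =>
    Subtype.ext (eq_zero_of_forall_coeff_rowContent f.2 (congrFun hf))

theorem rowCoeffLin_schurSumLin (A : YoungDiagram → K) (mu : YoungDiagram) :
    rowCoeffLin (schurSumLin A) mu = A mu + ∑ lam ∈ (ofCard mu.card).erase mu,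
      A lam * MvPowerSeries.coeff (rowContent mu) (schur K lam) := by
  rw [rowCoeffLin_apply, schurSumLin_apply_coe, coeff_schurSum, rowContent, degree_content,
    ← rowContent, ← Finset.add_sum_erase _ _ (mem_ofCard.mpr rfl),
    coeff_rowContent_schur_self, mul_one]

theorem rowCoeffLin_comp_schurSumLin_bijective :
    Function.Bijective (rowCoeffLin ∘ schurSumLin (K := K)) := by
  have bijective := bijective_of_unitriangular rowIndexSum
    (fun (A : YoungDiagram → K) mu => ∑ lam ∈ (ofCard mu.card).erase mu,
      A lam * MvPowerSeries.coeff (rowContent mu) (schur K lam)) fun A B mu h =>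
    Finset.sum_congr rfl fun lam hlam => by
      rcases lt_or_ge (rowIndexSum lam) (rowIndexSum mu) with hlt | hle
      · rw [h lam hlt]
      · rw [coeff_rowContent_schur_eq_zero (Finset.ne_of_mem_erase hlam) hle, mul_zero, mul_zero]
  convert bijective using 1
  exact funext fun A => funext fun mu => rowCoeffLin_schurSumLin A mu

theorem schurSumLin_bijective : Function.Bijective (schurSumLin (K := K)) :=
  ⟨rowCoeffLin_comp_schurSumLin_bijective.injective.of_comp,
    rowCoeffLin_comp_schurSumLin_bijective.surjective.of_comp_left rowCoeffLin_injective⟩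

/-- The linear isomorphism which takes a symmetric power series to the coefficients of its Schur
expansion. -/
noncomputable def schurCoeffEquiv : SymSeries K ≃ₗ[K] (YoungDiagram → K) :=
  (LinearEquiv.ofBijective schurSumLin schurSumLin_bijective).symm

theorem schurSum_schurCoeffEquiv (f : SymSeries K) : schurSum (schurCoeffEquiv f) = f :=
  congrArg Subtype.val
    ((LinearEquiv.ofBijective schurSumLin schurSumLin_bijective).apply_symm_apply f)

theorem schurSum_injective : Function.Injective (schurSum (K := K)) := fun _ _ h =>
  schurSumLin_bijective.injective (Subtype.ext h)

theorem schurCoeff_schurSum (A : YoungDiagram → K) : schurCoeff (schurSum A) = A := by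
  have h : ∃ B : YoungDiagram → K, schurSum B = schurSum A := ⟨A, rfl⟩
  rw [schurCoeff, dif_pos h]
  exact schurSum_injective h.choose_spec

theorem schurCoeff_eq_schurCoeffEquiv (f : SymSeries K) :
    schurCoeff (f : MvPowerSeries ℕ K) = schurCoeffEquiv f := by
  conv_lhs => rw [← schurSum_schurCoeffEquiv f, schurCoeff_schurSum]

theorem schurCoeff_add (F G : SymSeries K) :
    schurCoeff (F + G : MvPowerSeries ℕ K) =
      schurCoeff (F : MvPowerSeries ℕ K) + schurCoeff (G : MvPowerSeries ℕ K) := by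
  rw [← Subalgebra.coe_add, schurCoeff_eq_schurCoeffEquiv, map_add,
    schurCoeff_eq_schurCoeffEquiv, schurCoeff_eq_schurCoeffEquiv]

theorem schurCoeff_smul (r : K) (F : SymSeries K) :
    schurCoeff (r • F : MvPowerSeries ℕ K) = r • schurCoeff (F : MvPowerSeries ℕ K) := by
  rw [← Subalgebra.coe_smul, schurCoeff_eq_schurCoeffEquiv, map_smul,
    schurCoeff_eq_schurCoeffEquiv]

theorem schurSum_schurCoeff {f : MvPowerSeries ℕ K} (hf : f ∈ SymSeries K) :
    schurSum (schurCoeff f) = f := by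
  rw [schurCoeff_eq_schurCoeffEquiv ⟨f, hf⟩, schurSum_schurCoeffEquiv]

theorem schurCoeff_eq_zero {f : MvPowerSeries ℕ K} (hf : f ∈ SymSeries K) {d : ℕ}
    (hd : ∀ n : ℕ →₀ ℕ, d < n.degree → MvPowerSeries.coeff n f = 0) {lam : YoungDiagram}
    (h : d < lam.card) : schurCoeff f lam = 0 := by
  have truncation : schurSum (fun lam => if lam.card ≤ d then schurCoeff f lam else 0) = f := by
    ext n
    rw [coeff_schurSum]
    rcases le_or_gt n.degree d with hn | hn
    · conv_rhs => rw [← schurSum_schurCoeff hf, coeff_schurSum]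
      refine Finset.sum_congr rfl fun lam hlam => ?_
      rw [if_pos ((mem_ofCard.mp hlam).trans_le hn)]
    · rw [hd n hn]
      refine Finset.sum_eq_zero fun lam hlam => ?_
      rw [if_neg ((mem_ofCard.mp hlam).symm ▸ hn.not_ge), zero_mul]
  rw [← truncation, schurCoeff_schurSum, if_neg h.not_ge]

theorem support_schurCoeff_subset {f : MvPowerSeries ℕ K} (hf : f ∈ SymSeries K) {d : ℕ}
    (hd : ∀ n : ℕ →₀ ℕ, d < n.degree → MvPowerSeries.coeff n f = 0) :
    Function.support (schurCoeff f) ⊆ (Finset.range (d + 1)).biUnion ofCard := by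
  refine fun lam h => Finset.mem_coe.mpr (Finset.mem_biUnion.mpr ⟨lam.card, ?_, mem_ofCard.mpr rfl⟩)
  rw [Finset.mem_range_succ_iff]
  exact not_lt.mp fun hlt => h (schurCoeff_eq_zero hf hd hlt)

theorem finite_support_schurCoeff (f : Sym K) :
    (Function.support (schurCoeff (f : MvPowerSeries ℕ K))).Finite := by
  obtain ⟨hf, d, hd⟩ := f.2
  exact (Finset.finite_toSet _).subset (support_schurCoeff_subset hf hd)

theorem finite_support_hall (F : SymSeries K) (f : Sym K) : (Function.support fun lam =>
    schurCoeff (F : MvPowerSeries ℕ K) lam * schurCoeff (f : MvPowerSeries ℕ K) lam).Finite :=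
  (finite_support_schurCoeff f).subset fun _ => right_ne_zero_of_mul

theorem isLinearMap_hall (F : SymSeries K) : IsLinearMap K (hall F) where
  map_add f g := by
    simp only [hall, ← finsum_add_distrib (finite_support_hall F f) (finite_support_hall F g),
      Subalgebra.coe_add, schurCoeff_add (K := K) ⟨f, f.2.1⟩ ⟨g, g.2.1⟩, Pi.add_apply, mul_add]
  map_smul r f := by
    simp only [hall, Subalgebra.coe_smul, schurCoeff_smul r ⟨f, f.2.1⟩, Pi.smul_apply, smul_eq_mul,
      mul_left_comm _ r, mul_finsum' _ _ (finite_support_hall F f)]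

theorem hallLin_apply (F : SymSeries K) (f : Sym K) : hallLin F f = hall F f := by
  rw [hallLin, dif_pos (isLinearMap_hall F), IsLinearMap.mk'_apply]

end SchurExpansion

section SingleRow

/-- The diagram with a single row of length `k`. -/
def rowDiagram (k : ℕ) : YoungDiagram where
  cells := {0} ×ˢ Finset.range k
  isLowerSet := by
    rintro ⟨i, j⟩ ⟨i', j'⟩ ⟨hi : i' ≤ i, hj : j' ≤ j⟩ hc
    simp only [Finset.mem_coe, Finset.mem_product, Finset.mem_singleton, Finset.mem_range] at hc ⊢
    exact ⟨Nat.le_zero.mp (hi.trans_eq hc.1), hj.trans_lt hc.2⟩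

theorem mem_rowDiagram {k i j : ℕ} : (i, j) ∈ rowDiagram k ↔ i = 0 ∧ j < k := by
  rw [← YoungDiagram.mem_cells, rowDiagram, Finset.mem_product, Finset.mem_singleton,
    Finset.mem_range]

theorem card_rowDiagram (k : ℕ) : (rowDiagram k).card = k := by
  rw [YoungDiagram.card, rowDiagram, Finset.card_product, Finset.card_singleton,
    Finset.card_range, one_mul]

theorem rowDiagram_injective : Function.Injective rowDiagram :=
  Function.LeftInverse.injective card_rowDiagram

theorem numCols_rowDiagram (m k : ℕ) : numCols (rowDiagram m) (rowDiagram k) = m - k := by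
  have columns : (skewCells (rowDiagram m) (rowDiagram k)).image Prod.snd = Finset.Ico k m := by
    ext j
    simp only [Finset.mem_image, Prod.exists, mem_skewCells, mem_rowDiagram, Finset.mem_Ico]
    grind
  rw [numCols, columns, Nat.card_Ico]

theorem between_bot_rowDiagram (m : ℕ) :
    between ⊥ (rowDiagram m) = (Finset.range (m + 1)).image rowDiagram := by
  ext nu
  simp only [mem_between, bot_le, true_and, Finset.mem_image, Finset.mem_range_succ_iff]
  constructor
  · intro h
    have row_eq_zero {i j : ℕ} (hc : (i, j) ∈ nu) : i = 0 := (mem_rowDiagram.mp (h hc)).1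
    refine ⟨nu.rowLen 0, ?_, ?_⟩
    · exact not_lt.mp fun hlt =>
        lt_irrefl m (mem_rowDiagram.mp (h (YoungDiagram.mem_iff_lt_rowLen.mpr hlt))).2
    · ext ⟨i, j⟩
      rw [YoungDiagram.mem_cells, YoungDiagram.mem_cells, mem_rowDiagram,
        ← YoungDiagram.mem_iff_lt_rowLen]
      exact ⟨fun ⟨hi, hj⟩ => hi ▸ hj, fun hc => ⟨row_eq_zero hc, row_eq_zero hc ▸ hc⟩⟩
  · rintro ⟨k, hk, rfl⟩ ⟨i, j⟩ hc
    obtain ⟨hi, hj⟩ := mem_rowDiagram.mp hc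
    exact mem_rowDiagram.mpr ⟨hi, hj.trans_le hk⟩

theorem rowIndexSum_rowDiagram (k : ℕ) : rowIndexSum (rowDiagram k) = 0 :=
  Finset.sum_eq_zero fun _ hc => (mem_rowDiagram.mp ((YoungDiagram.mem_cells _).mp hc)).1

theorem rowContent_rowDiagram (k : ℕ) : rowContent (rowDiagram k) = Finsupp.single 0 k := by
  ext i
  rw [rowContent_apply, Finsupp.single_apply]
  refine eq_of_forall_lt_iff fun j => ?_
  rw [← YoungDiagram.mem_iff_lt_rowLen, mem_rowDiagram]
  grind

end SingleRow

section HallCompleteSeries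

variable {K : Type*} [CommRing K]

theorem stepProd_bot_rowDiagram (n : ℕ →₀ ℕ) (m : ℕ) :
    stepProd K n ⊥ (rowDiagram m) = if n.degree = m then 1 else 0 := by
  induction n using Finsupp.induction generalizing m with
  | zero =>
    have bot_eq : ⊥ = rowDiagram 0 := rfl
    rw [stepProd_zero, IncidenceAlgebra.one_apply, map_zero, bot_eq]
    simp only [rowDiagram_injective.eq_iff]
  | single_add i k n hi hk ih =>
    rw [add_comm, stepProd_add_single (Finsupp.notMem_support_iff.mp hi), mul_stepElem_apply,
      between_bot_rowDiagram, Finset.sum_image rowDiagram_injective.injOn, map_add,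
      Finsupp.degree_single]
    simp only [numCols_rowDiagram, ih]
    rw [Finset.sum_eq_ite n.degree]
    · grind
    · grind

theorem coeff_schur_rowDiagram (n : ℕ →₀ ℕ) :
    MvPowerSeries.coeff n (schur K (rowDiagram n.degree)) = 1 := by
  rw [coeff_schur_of_degree_eq_card K (card_rowDiagram _).symm,
    coeff_dualGroth_eq_stepProd K bot_le, stepProd_bot_rowDiagram, if_pos rfl]

open Classical in
theorem schurCoeff_H (t : K) (lam : YoungDiagram) :
    schurCoeff (H t : MvPowerSeries ℕ K) lam =
      if lam = rowDiagram lam.card then t ^ lam.card else 0 := by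
  have expansion : schurSum (fun lam => if lam = rowDiagram lam.card then t ^ lam.card else 0) =
      (H t : MvPowerSeries ℕ K) := by
    ext n
    refine Eq.trans ?_ (completeSeries_coeff t n).symm
    rw [coeff_schurSum, Finset.sum_eq_single_of_mem (rowDiagram n.degree)
      (mem_ofCard.mpr (card_rowDiagram _))]
    · rw [card_rowDiagram, if_pos rfl, coeff_schur_rowDiagram, mul_one]
    · intro lam hlam hne
      rw [if_neg ((mem_ofCard.mp hlam).symm ▸ hne), zero_mul]
  rw [← expansion, schurCoeff_schurSum]

theorem schurCoeff_rowDiagram {f : MvPowerSeries ℕ K} (hf : f ∈ SymSeries K) (k : ℕ) :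
    schurCoeff f (rowDiagram k) = MvPowerSeries.coeff (Finsupp.single 0 k) f := by
  conv_rhs => rw [← schurSum_schurCoeff hf, coeff_schurSum, Finsupp.degree_single,
    ← rowContent_rowDiagram]
  rw [Finset.sum_eq_single_of_mem (rowDiagram k) (mem_ofCard.mpr (card_rowDiagram k)),
    coeff_rowContent_schur_self, mul_one]
  intro lam _ hne
  rw [coeff_rowContent_schur_eq_zero hne ((rowIndexSum_rowDiagram k).trans_le (Nat.zero_le _)),
    mul_zero]

theorem hall_H (t : K) (f : Sym K) :
    hall (H t) f =
      ∑ᶠ k, t ^ k * MvPowerSeries.coeff (Finsupp.single 0 k) (f : MvPowerSeries ℕ K) := by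
  classical
  have support_subset : (Function.support fun lam => schurCoeff (H t : MvPowerSeries ℕ K) lam *
      schurCoeff (f : MvPowerSeries ℕ K) lam) ⊆ Set.range rowDiagram := by
    intro lam h
    by_contra hrow
    refine h (mul_eq_zero_of_left ?_ _)
    rw [schurCoeff_H, if_neg fun heq => hrow ⟨_, heq.symm⟩]
  rw [hall, ← finsum_mem_univ, finsum_mem_inter_support_eq _ _ (Set.range rowDiagram)
    (by rw [Set.univ_inter, Set.inter_eq_right.mpr support_subset]),
    finsum_mem_range rowDiagram_injective]
  refine finsum_congr fun k => ?_
  rw [schurCoeff_H, card_rowDiagram, if_pos rfl, schurCoeff_rowDiagram f.2.1]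

end HallCompleteSeries

section RelabelVariables

theorem exists_perm_apply_eq_of_injOn {α β : Type*} (s : Finset α) {e₁ e₂ : α → β}
    (h₁ : Set.InjOn e₁ s) (h₂ : Set.InjOn e₂ s) :
    ∃ σ : Equiv.Perm β, ∀ x ∈ s, σ (e₁ x) = e₂ x := by
  let listing (e : α → β) (h : Set.InjOn e s) : Fin s.card ↪ β :=
    s.equivFin.symm.toEmbedding.trans ⟨s.restrict e, Set.injOn_iff_injective.mp h⟩
  obtain ⟨σ, hσ⟩ := MulAction.isMultiplyPretransitive_iff.mp
    (Equiv.Perm.isMultiplyPretransitive β s.card) (listing e₁ h₁) (listing e₂ h₂)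
  refine ⟨σ, fun x hx => ?_⟩
  have listing_apply (e h) : listing e h (s.equivFin ⟨x, hx⟩) = e x :=
    congrArg (s.restrict e) (Equiv.symm_apply_apply _ _)
  rw [← listing_apply e₁ h₁, ← listing_apply e₂ h₂, ← hσ]
  rfl

variable {K : Type*} [CommRing K] {f : MvPowerSeries ℕ K}

theorem coeff_mapDomain_eq_of_mem_SymSeries (hf : f ∈ SymSeries K) {α : Type*} (m : α →₀ ℕ)
    {e₁ e₂ : α → ℕ} (h₁ : Set.InjOn e₁ m.support) (h₂ : Set.InjOn e₂ m.support) :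
    MvPowerSeries.coeff (m.mapDomain e₁) f = MvPowerSeries.coeff (m.mapDomain e₂) f := by
  obtain ⟨σ, hσ⟩ := exists_perm_apply_eq_of_injOn m.support h₁ h₂
  rw [← mem_SymSeries_iff.mp hf σ, ← Finsupp.mapDomain_comp]
  exact congrArg (MvPowerSeries.coeff · f) (Finsupp.mapDomain_congr hσ)

theorem single_add_mapDomain_eq_mapDomain_optionElim {α β : Type*} (k : ℕ) (n : α →₀ ℕ) (i : β)
    (e : α → β) :
    Finsupp.single i k + n.mapDomain e = (n.optionElim k).mapDomain (Option.elim · i e) := by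
  have optionElim_eq : n.optionElim k = Finsupp.single none k + n.mapDomain some := by
    ext (_ | a)
    · rw [Finsupp.optionElim_apply_none, Finsupp.add_apply, Finsupp.single_eq_same,
        Finsupp.mapDomain_of_notMem_range _ _ (by simp), add_zero]
    · rw [Finsupp.optionElim_apply_some, Finsupp.add_apply,
        Finsupp.single_eq_of_ne (Option.some_ne_none a),
        Finsupp.mapDomain_apply (Option.some_injective _), zero_add]
  rw [optionElim_eq, Finsupp.mapDomain_add, Finsupp.mapDomain_single, ← Finsupp.mapDomain_comp]
  rfl

/-- The exponent `(k, n₀, n₁, …)`. -/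
noncomputable def consExp (k : ℕ) (n : ℕ →₀ ℕ) : ℕ →₀ ℕ :=
  Finsupp.single 0 k + n.mapDomain Nat.succ

theorem degree_consExp (k : ℕ) (n : ℕ →₀ ℕ) : (consExp k n).degree = k + n.degree := by
  rw [consExp, map_add, Finsupp.degree_single, Finsupp.degree_mapDomain]

theorem coeff_single_add_mapDomain (hf : f ∈ SymSeries K) (k : ℕ) (n : ℕ →₀ ℕ) {i : ℕ}
    {e : ℕ → ℕ} (he : Function.Injective e) (hi : i ∉ Set.range e) :
    MvPowerSeries.coeff (Finsupp.single i k + n.mapDomain e) f =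
      MvPowerSeries.coeff (consExp k n) f := by
  have injective {i : ℕ} {e : ℕ → ℕ} (he : Function.Injective e) (hi : i ∉ Set.range e) :
      Function.Injective (Option.elim · i e) := Option.injective_iff.mpr ⟨he, hi⟩
  rw [consExp, single_add_mapDomain_eq_mapDomain_optionElim,
    single_add_mapDomain_eq_mapDomain_optionElim]
  exact coeff_mapDomain_eq_of_mem_SymSeries hf _ (injective he hi).injOn
    (injective Nat.succ_injective (by simp)).injOn

theorem coeff_consExp_zero (hf : f ∈ SymSeries K) (n : ℕ →₀ ℕ) :
    MvPowerSeries.coeff (consExp 0 n) f = MvPowerSeries.coeff n f := by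
  rw [consExp, Finsupp.single_zero, zero_add, coeff_mapDomain_eq_of_mem_SymSeries hf n
    Nat.succ_injective.injOn (Set.injOn_id _), Finsupp.mapDomain_id]

end RelabelVariables

section Substitution

variable {K : Type*} [CommRing K]

variable (K) in
/-- The map `f ↦ f(X, x₁, x₂, …)`, a power series in `X` whose coefficients are power series in
`x₁, x₂, …`. -/
noncomputable def splitFirst : MvPowerSeries ℕ K →ₐ[K] PowerSeries (MvPowerSeries ℕ K) :=
  (MvPowerSeries.optionEquivLeft ℕ K).toAlgHom.comp (MvPowerSeries.rename (R := K)
    (Equiv.natEquivNatSumPUnit.{0}.trans (Equiv.optionEquivSumPUnit ℕ).symm))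

theorem coeff_coeff_splitFirst (f : MvPowerSeries ℕ K) (k : ℕ) (n : ℕ →₀ ℕ) :
    MvPowerSeries.coeff n (PowerSeries.coeff k (splitFirst K f)) =
      MvPowerSeries.coeff (consExp k n) f := by
  refine (MvPowerSeries.coeff_coeff_optionEquivLeft _ k n).trans ?_
  rw [← coeff_mapDomain_rename_equiv _ f]
  congr 2
  rw [consExp, single_add_mapDomain_eq_mapDomain_optionElim, ← Finsupp.mapDomain_comp]
  exact (Finsupp.mapDomain_id.symm).trans
    (congrArg (Finsupp.mapDomain · _) (funext fun o => by cases o <;> rfl))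

theorem substFirst_eq_eval (t : K) {f : MvPowerSeries ℕ K} {P : Polynomial (MvPowerSeries ℕ K)}
    (hP : (P : PowerSeries (MvPowerSeries ℕ K)) = splitFirst K f) :
    substFirst t f = P.eval (MvPowerSeries.C t) := by
  have coeff_consExp (k n) : MvPowerSeries.coeff (consExp k n) f =
      MvPowerSeries.coeff n (P.coeff k) := by
    rw [← coeff_coeff_splitFirst, ← hP, Polynomial.coeff_coe]
  ext n
  rw [Polynomial.eval_eq_sum_range, map_sum]
  refine (finsum_congr fun k => congrArg _ (coeff_consExp k n)).trans ?_
  rw [finsum_eq_sum_of_support_subset (s := Finset.range (P.natDegree + 1))]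
  · refine Finset.sum_congr rfl fun k _ => ?_
    rw [← map_pow, MvPowerSeries.coeff_mul_C, mul_comm]
  · intro k hk
    rw [Finset.mem_coe, Finset.mem_range_succ_iff]
    by_contra! hlt
    exact hk (by simp [Polynomial.coeff_eq_zero_of_natDegree_lt hlt])

theorem exists_polynomial_eq_splitFirst {f : MvPowerSeries ℕ K} (hf : BoundedDegree f) :
    ∃ P : Polynomial (MvPowerSeries ℕ K),
      (P : PowerSeries (MvPowerSeries ℕ K)) = splitFirst K f := by
  obtain ⟨d, hd⟩ := hf
  refine ⟨PowerSeries.trunc (d + 1) (splitFirst K f), ?_⟩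
  ext k n
  rw [Polynomial.coeff_coe, PowerSeries.coeff_trunc]
  split_ifs with hk
  · rfl
  · rw [coeff_coeff_splitFirst, hd _ (by rw [degree_consExp]; lia), map_zero]

theorem substFirst_mem_Sym (t : K) (f : Sym K) :
    substFirst t (f : MvPowerSeries ℕ K) ∈ Sym K := by
  obtain ⟨hf, d, hd⟩ := f.2
  refine ⟨mem_SymSeries_iff.mpr fun σ n => finsum_congr fun k => congrArg _ ?_, d, fun n hn => ?_⟩
  · rw [← Finsupp.mapDomain_comp]
    exact coeff_single_add_mapDomain hf k n (Nat.succ_injective.comp σ.injective) (by simp)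
  · refine finsum_eq_zero_of_forall_eq_zero fun k => ?_
    rw [← consExp, hd _ (by rw [degree_consExp]; lia), mul_zero]

theorem substFirst_add (t : K) {f g : MvPowerSeries ℕ K} (hf : BoundedDegree f)
    (hg : BoundedDegree g) : substFirst t (f + g) = substFirst t f + substFirst t g := by
  obtain ⟨P, hP⟩ := exists_polynomial_eq_splitFirst hf
  obtain ⟨Q, hQ⟩ := exists_polynomial_eq_splitFirst hg
  rw [substFirst_eq_eval t hP, substFirst_eq_eval t hQ, ← Polynomial.eval_add]
  exact substFirst_eq_eval t (by rw [Polynomial.coe_add, hP, hQ, map_add])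

theorem substFirst_mul (t : K) {f g : MvPowerSeries ℕ K} (hf : BoundedDegree f)
    (hg : BoundedDegree g) : substFirst t (f * g) = substFirst t f * substFirst t g := by
  obtain ⟨P, hP⟩ := exists_polynomial_eq_splitFirst hf
  obtain ⟨Q, hQ⟩ := exists_polynomial_eq_splitFirst hg
  rw [substFirst_eq_eval t hP, substFirst_eq_eval t hQ, ← Polynomial.eval_mul]
  exact substFirst_eq_eval t (by rw [Polynomial.coe_mul, hP, hQ, map_mul])

theorem substFirst_algebraMap (t r : K) :
    substFirst t (algebraMap K (MvPowerSeries ℕ K) r) = algebraMap K (MvPowerSeries ℕ K) r := by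
  have hP : ((Polynomial.C (algebraMap K _ r) : Polynomial (MvPowerSeries ℕ K)) :
      PowerSeries (MvPowerSeries ℕ K)) = splitFirst K (algebraMap K _ r) := by
    rw [Polynomial.coe_C, AlgHom.commutes, PowerSeries.algebraMap_apply]
  rw [substFirst_eq_eval t hP, Polynomial.eval_C]

/-- The substitution `f ↦ f(t, x₁, x₂, …)` as an algebra endomorphism of the ring of symmetric
functions. -/
noncomputable def substHom (t : K) : Sym K →ₐ[K] Sym K where
  toFun f := ⟨substFirst t f, substFirst_mem_Sym t f⟩
  map_zero' := Subtype.ext <| by simpa using substFirst_algebraMap t 0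
  map_one' := Subtype.ext <| by simpa using substFirst_algebraMap t 1
  map_add' f g := Subtype.ext (substFirst_add t f.2.2 g.2.2)
  map_mul' f g := Subtype.ext (substFirst_mul t f.2.2 g.2.2)
  commutes' r := Subtype.ext (substFirst_algebraMap t r)

theorem coeff_substFirst_of_degree_le (t : K) {f : MvPowerSeries ℕ K} (hf : f ∈ SymSeries K)
    {d : ℕ} (hd : ∀ n : ℕ →₀ ℕ, d < n.degree → MvPowerSeries.coeff n f = 0) {n : ℕ →₀ ℕ}
    (hn : d ≤ n.degree) :
    MvPowerSeries.coeff n (substFirst t f) = MvPowerSeries.coeff n f := by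
  refine (finsum_eq_single _ 0 fun k hk => ?_).trans ?_
  · rw [← consExp, hd _ (by rw [degree_consExp]; lia), mul_zero]
  · rw [← consExp, pow_zero, one_mul, coeff_consExp_zero hf]

theorem pow_substHom_sub_one_eq_zero (t : K) {d : ℕ} {f : Sym K}
    (hf : ∀ n : ℕ →₀ ℕ, d ≤ n.degree →
      MvPowerSeries.coeff n (f : MvPowerSeries ℕ K) = 0) :
    (((substHom t).toLinearMap - 1 : Module.End K (Sym K)) ^ d) f = 0 := by
  induction d generalizing f with
  | zero => exact Subtype.ext (MvPowerSeries.ext fun n => hf n (Nat.zero_le _))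
  | succ d ih =>
    rw [pow_succ, Module.End.mul_apply]
    refine ih fun n hn => ?_
    change MvPowerSeries.coeff n (substFirst t f - f : MvPowerSeries ℕ K) = 0
    rw [map_sub, coeff_substFirst_of_degree_le t f.2.1 hf hn, sub_self]

theorem substHom_bijective (t : K) : Function.Bijective (substHom t) := by
  let φ : Module.End K (Sym K) := (substHom t).toLinearMap
  have bijective : Function.Bijective (1 + (φ - 1) : Module.End K (Sym K)) :=
    bijective_one_add_of_locally_nilpotent (φ - 1) fun f => by
      obtain ⟨-, d, hd⟩ := f.2
      exact ⟨d + 1, pow_substHom_sub_one_eq_zero t hd⟩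
  have eq : (1 + (φ - 1) : Module.End K (Sym K)) = φ := add_sub_cancel 1 φ
  exact (congrArg (fun ψ : Module.End K (Sym K) => Function.Bijective ψ) eq).mp bijective

end Substitution

section TwoAlphabets

theorem mapDomain_map_sumElim {α β α' β' M : Type*} [AddCommMonoid M] (e : α → α') (e' : β → β')
    (a : α →₀ M) (b : β →₀ M) :
    (a.sumElim b).mapDomain (Sum.map e e') = (a.mapDomain e).sumElim (b.mapDomain e') := by
  simp only [Finsupp.sumElim_eq_add, Finsupp.mapDomain_add, ← Finsupp.mapDomain_comp]
  rfl

theorem sumElim_inj {α β M : Type*} [Zero M] {a a' : α →₀ M} {b b' : β →₀ M} :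
    a.sumElim b = a'.sumElim b' ↔ a = a' ∧ b = b' := by
  rw [← Prod.mk.injEq]
  exact Finsupp.sumFinsuppEquivProdFinsupp.symm.injective.eq_iff (a := (a, b)) (b := (a', b'))

theorem coeff_sumElim_rename_inl_mul_rename_inr {R : Type*} [CommSemiring R] {α β : Type*}
    (p : MvPowerSeries α R) (q : MvPowerSeries β R) (a : α →₀ ℕ) (b : β →₀ ℕ) :
    MvPowerSeries.coeff (a.sumElim b)
      (MvPowerSeries.rename (R := R) (Function.Embedding.inl : α ↪ α ⊕ β) p *
        MvPowerSeries.rename (R := R) (Function.Embedding.inr : β ↪ α ⊕ β) q) =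
      MvPowerSeries.coeff a p * MvPowerSeries.coeff b q := by
  classical
  have embDomain_add_embDomain (u : α →₀ ℕ) (v : β →₀ ℕ) :
      u.embDomain Function.Embedding.inl + v.embDomain Function.Embedding.inr = u.sumElim v := by
    rw [Finsupp.embDomain_inl, Finsupp.embDomain_inr, ← Finsupp.sumElim_add, add_zero, zero_add]
  rw [MvPowerSeries.coeff_mul, Finset.sum_eq_single_of_mem
    (a.embDomain Function.Embedding.inl, b.embDomain Function.Embedding.inr)
    (Finset.HasAntidiagonal.mem_antidiagonal.mpr (embDomain_add_embDomain a b)),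
    MvPowerSeries.coeff_embDomain_rename, MvPowerSeries.coeff_embDomain_rename]
  rintro ⟨u, v⟩ huv hne
  contrapose! hne
  obtain ⟨u, rfl⟩ := not_imp_comm.mp (MvPowerSeries.coeff_rename_eq_zero _ p)
    (left_ne_zero_of_mul hne)
  obtain ⟨v, rfl⟩ := not_imp_comm.mp (MvPowerSeries.coeff_rename_eq_zero _ q)
    (right_ne_zero_of_mul hne)
  rw [← Finsupp.embDomain_eq_mapDomain, ← Finsupp.embDomain_eq_mapDomain,
    Finset.HasAntidiagonal.mem_antidiagonal, embDomain_add_embDomain, sumElim_inj] at huv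
  rw [← Finsupp.embDomain_eq_mapDomain, ← Finsupp.embDomain_eq_mapDomain, huv.1, huv.2]

end TwoAlphabets

section Coproduct

variable {K : Type*} [CommRing K]

theorem coeff_twoAlphabets (f : MvPowerSeries ℕ K) (c : ℕ ⊕ ℕ →₀ ℕ) :
    MvPowerSeries.coeff c (twoAlphabets f) =
      MvPowerSeries.coeff (c.mapDomain Equiv.natSumNatEquivNat) f := by
  rw [← coeff_mapDomain_rename_equiv Equiv.natSumNatEquivNat.symm f, ← Finsupp.mapDomain_comp,
    Equiv.symm_comp_self, Finsupp.mapDomain_id]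
  rfl

theorem coeff_twoAlphabets_sumElim_mapDomain {f : MvPowerSeries ℕ K} (hf : f ∈ SymSeries K)
    (σ τ : Equiv.Perm ℕ) (a b : ℕ →₀ ℕ) :
    MvPowerSeries.coeff ((a.mapDomain σ).sumElim (b.mapDomain τ)) (twoAlphabets f) =
      MvPowerSeries.coeff (a.sumElim b) (twoAlphabets f) := by
  rw [coeff_twoAlphabets, coeff_twoAlphabets, ← mapDomain_map_sumElim, ← Finsupp.mapDomain_comp]
  have relabeling := Equiv.natSumNatEquivNat.injective.comp (σ.injective.sumMap τ.injective)
  exact coeff_mapDomain_eq_of_mem_SymSeries hf _ relabeling.injOn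
    Equiv.natSumNatEquivNat.injective.injOn

/-- The coefficient of `y^b` in `f(x, y)`, a power series in `x`. -/
noncomputable def sliceSeries (f : MvPowerSeries ℕ K) (b : ℕ →₀ ℕ) : MvPowerSeries ℕ K :=
  fun a => MvPowerSeries.coeff (a.sumElim b) (twoAlphabets f)

theorem coeff_sliceSeries (f : MvPowerSeries ℕ K) (a b : ℕ →₀ ℕ) :
    MvPowerSeries.coeff a (sliceSeries f b) =
      MvPowerSeries.coeff (a.sumElim b) (twoAlphabets f) := rfl

theorem sliceSeries_mem_SymSeries {f : MvPowerSeries ℕ K} (hf : f ∈ SymSeries K) (b : ℕ →₀ ℕ) :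
    sliceSeries f b ∈ SymSeries K := by
  refine mem_SymSeries_iff.mpr fun σ a => ?_
  simpa only [coeff_sliceSeries, Equiv.Perm.coe_one, Finsupp.mapDomain_id] using
    coeff_twoAlphabets_sumElim_mapDomain hf σ 1 a b

theorem sliceSeries_mapDomain {f : MvPowerSeries ℕ K} (hf : f ∈ SymSeries K)
    (τ : Equiv.Perm ℕ) (b : ℕ →₀ ℕ) : sliceSeries f (b.mapDomain τ) = sliceSeries f b := by
  ext a
  simpa only [coeff_sliceSeries, Equiv.Perm.coe_one, Finsupp.mapDomain_id] using
    coeff_twoAlphabets_sumElim_mapDomain hf 1 τ a b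

theorem coeff_sliceSeries_eq_zero {f : MvPowerSeries ℕ K} {d : ℕ}
    (hd : ∀ n : ℕ →₀ ℕ, d < n.degree → MvPowerSeries.coeff n f = 0) {a b : ℕ →₀ ℕ}
    (h : d < a.degree + b.degree) : MvPowerSeries.coeff a (sliceSeries f b) = 0 := by
  rw [coeff_sliceSeries, coeff_twoAlphabets, hd]
  rwa [Finsupp.degree_mapDomain, Finsupp.sumElim_eq_add, map_add, Finsupp.degree_mapDomain,
    Finsupp.degree_mapDomain]

/-- The coefficient of `s_λ(x)` in `f(x, y)`, a symmetric function in `y`. -/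
noncomputable def schurSlice (f : Sym K) (lam : YoungDiagram) : Sym K :=
  ⟨fun b => schurCoeff (sliceSeries (f : MvPowerSeries ℕ K) b) lam, by
    obtain ⟨hf, d, hd⟩ := f.2
    refine ⟨mem_SymSeries_iff.mpr fun σ b => ?_, d, fun b hb => ?_⟩
    · exact congrArg (schurCoeff · lam) (sliceSeries_mapDomain hf σ b)
    · have slice_eq_zero : sliceSeries (f : MvPowerSeries ℕ K) b = 0 := by
        ext a
        exact coeff_sliceSeries_eq_zero hd (by lia)
      have schurCoeff_zero := schurCoeff_smul (0 : K) 0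
      rw [zero_smul, zero_smul] at schurCoeff_zero
      exact congrFun ((congrArg schurCoeff slice_eq_zero).trans schurCoeff_zero) lam⟩

theorem coeff_schurSlice (f : Sym K) (lam : YoungDiagram) (b : ℕ →₀ ℕ) :
    MvPowerSeries.coeff b (schurSlice f lam : MvPowerSeries ℕ K) =
      schurCoeff (sliceSeries (f : MvPowerSeries ℕ K) b) lam := rfl

theorem coeff_tensorToSeries_tmul (p q : Sym K) (a b : ℕ →₀ ℕ) :
    MvPowerSeries.coeff (a.sumElim b) (tensorToSeries K (p ⊗ₜ q)) =
      MvPowerSeries.coeff a (p : MvPowerSeries ℕ K) *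
        MvPowerSeries.coeff b (q : MvPowerSeries ℕ K) :=
  coeff_sumElim_rename_inl_mul_rename_inr _ _ a b

theorem exists_tensorToSeries_eq_twoAlphabets (f : Sym K) :
    ∃ T : Sym K ⊗[K] Sym K, tensorToSeries K T = twoAlphabets (f : MvPowerSeries ℕ K) := by
  obtain ⟨hf, d, hd⟩ := f.2
  classical
  refine ⟨∑ lam ∈ (Finset.range (d + 1)).biUnion ofCard,
    ⟨schur K lam, schur_mem_Sym K lam⟩ ⊗ₜ schurSlice f lam, ?_⟩
  ext c
  obtain ⟨⟨a, b⟩, rfl⟩ := Finsupp.sumFinsuppEquivProdFinsupp.symm.surjective c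
  rw [Finsupp.sumFinsuppEquivProdFinsupp_symm_apply, ← coeff_sliceSeries, map_sum, map_sum,
    ← schurSum_schurCoeff (sliceSeries_mem_SymSeries hf b)]
  have slice_support := support_schurCoeff_subset (sliceSeries_mem_SymSeries hf b) (d := d)
    fun a ha => coeff_sliceSeries_eq_zero hd (ha.trans_le (Nat.le_add_right _ _))
  refine Eq.trans ?_ (finsum_eq_sum_of_support_subset _ fun lam hlam =>
    slice_support (left_ne_zero_of_mul hlam)).symm
  refine Finset.sum_congr rfl fun lam _ => ?_
  rw [coeff_tensorToSeries_tmul, coeff_schurSlice, mul_comm]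

theorem tensorToSeries_coproduct (f : Sym K) :
    tensorToSeries K (coproduct f) = twoAlphabets (f : MvPowerSeries ℕ K) := by
  rw [coproduct, dif_pos (exists_tensorToSeries_eq_twoAlphabets f)]
  exact (exists_tensorToSeries_eq_twoAlphabets f).choose_spec

end Coproduct

section Perp

variable {K : Type*} [CommRing K]

theorem finite_support_coeff_single {f : MvPowerSeries ℕ K} (hf : BoundedDegree f) (i : ℕ) :
    (Function.support fun k => MvPowerSeries.coeff (Finsupp.single i k) f).Finite := by
  obtain ⟨d, hd⟩ := hf
  refine (Set.finite_Iic d).subset fun k hk => ?_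
  exact not_lt.mp fun hlt => hk (hd _ (by rwa [Finsupp.degree_single]))

theorem finite_support_coeff_single_sumElim (T : Sym K ⊗[K] Sym K) (n : ℕ →₀ ℕ) :
    (Function.support fun k =>
      MvPowerSeries.coeff ((Finsupp.single 0 k).sumElim n) (tensorToSeries K T)).Finite := by
  induction T with
  | zero => simp only [map_zero, Function.support_fun_zero, Set.finite_empty]
  | tmul p q =>
    simp only [coeff_tensorToSeries_tmul]
    exact (finite_support_coeff_single p.2.2 0).subset fun _ => left_ne_zero_of_mul
  | add S T hS hT =>
    simp only [map_add]
    exact (hS.union hT).subset (Function.support_add _ _)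

theorem coeff_lid_rTensor_hallLin_H (t : K) (T : Sym K ⊗[K] Sym K) (n : ℕ →₀ ℕ) :
    MvPowerSeries.coeff n ((TensorProduct.lid K (Sym K)
        ((hallLin (H t)).rTensor (Sym K) T) : Sym K) : MvPowerSeries ℕ K) =
      ∑ᶠ k, t ^ k *
        MvPowerSeries.coeff ((Finsupp.single 0 k).sumElim n) (tensorToSeries K T) := by
  induction T with
  | zero => simp only [map_zero, Subalgebra.coe_zero, mul_zero, finsum_zero]
  | tmul p q =>
    rw [LinearMap.rTensor_tmul, TensorProduct.lid_tmul, hallLin_apply, hall_H,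
      Subalgebra.coe_smul, map_smul, smul_eq_mul, finsum_mul' _ _
        ((finite_support_coeff_single p.2.2 0).subset fun _ => right_ne_zero_of_mul)]
    simp only [coeff_tensorToSeries_tmul, mul_assoc]
  | add S T hS hT =>
    have finite_support (T) := (finite_support_coeff_single_sumElim T n).subset
      (Function.support_mul_subset_right (fun k => t ^ k) _)
    simp only [map_add, Subalgebra.coe_add, hS, hT, mul_add]
    exact (finsum_add_distrib (finite_support S) (finite_support T)).symm

theorem perp_H (t : K) (f : Sym K) : perp (H t) f = substHom t f := by
  ext n
  rw [perp, coeff_lid_rTensor_hallLin_H, tensorToSeries_coproduct]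
  refine finsum_congr fun k => congrArg _ ?_
  rw [coeff_twoAlphabets, Finsupp.sumElim_eq_add, Finsupp.mapDomain_add,
    ← Finsupp.mapDomain_comp, ← Finsupp.mapDomain_comp, Finsupp.mapDomain_single]
  exact coeff_single_add_mapDomain f.2.1 k n
    (Equiv.natSumNatEquivNat.injective.comp Sum.inr_injective) (by simp)

end Perp

section DualGroth

theorem finsum_mul_sum_ite_eq {R ι α : Type*} [NonUnitalNonAssocSemiring R] [DecidableEq ι]
    (w : ι → R) (s : Finset α) (c : α → ι) (a : α → R) :
    ∑ᶠ k, w k * ∑ x ∈ s, (if c x = k then a x else 0) = ∑ x ∈ s, w (c x) * a x := by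
  rw [finsum_eq_sum_of_support_subset (s := s.image c)]
  · simp only [Finset.mul_sum]
    rw [Finset.sum_comm]
    refine Finset.sum_congr rfl fun x hx => ?_
    simp only [mul_ite, mul_zero, Finset.sum_ite_eq, if_pos (Finset.mem_image_of_mem c hx)]
  · intro k hk
    obtain ⟨x, hx, hne⟩ := Finset.exists_ne_zero_of_sum_ne_zero (right_ne_zero_of_mul hk)
    exact Finset.mem_image.mpr ⟨x, hx, of_not_not fun h => hne (if_neg h)⟩

variable {K : Type*} [CommRing K]

theorem stepProd_consExp (k : ℕ) (n : ℕ →₀ ℕ) :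
    stepProd K (consExp k n) = stepProd K n * stepElem K k := by
  rw [consExp, add_comm,
    stepProd_add_single (Finsupp.mapDomain_of_notMem_range _ _ (by simp)),
    stepProd_mapDomain Nat.succ_injective]

theorem coeff_substFirst_dualGroth (t : K) {mu lam : YoungDiagram} (h : mu ≤ lam) (n : ℕ →₀ ℕ) :
    MvPowerSeries.coeff n (substFirst t (dualGroth K lam mu)) =
      ∑ᶠ k, t ^ k * (stepProd K n * stepElem K k) mu lam :=
  finsum_congr fun k => by
    rw [← stepProd_consExp, ← coeff_dualGroth_eq_stepProd K h, consExp]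

theorem substFirst_dualGroth_left (t : K) {mu lam : YoungDiagram} (h : mu ≤ lam) :
    substFirst t (dualGroth K lam mu) =
      ∑ nu ∈ between mu lam, t ^ numCols lam nu • dualGroth K nu mu := by
  ext n
  simp only [coeff_substFirst_dualGroth t h, mul_stepElem_apply, finsum_mul_sum_ite_eq, map_sum]
  refine Finset.sum_congr rfl fun nu hnu => ?_
  rw [map_smul, smul_eq_mul, coeff_dualGroth_eq_stepProd K (mem_between.mp hnu).1]

theorem substFirst_dualGroth_right (t : K) {mu lam : YoungDiagram} (h : mu ≤ lam) :
    substFirst t (dualGroth K lam mu) =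
      ∑ nu ∈ between mu lam, t ^ numCols nu mu • dualGroth K lam nu := by
  ext n
  simp only [coeff_substFirst_dualGroth t h, ← (commute_stepElem_stepProd _ n).eq,
    stepElem_mul_apply, finsum_mul_sum_ite_eq, map_sum]
  refine Finset.sum_congr rfl fun nu hnu => ?_
  rw [map_smul, smul_eq_mul, coeff_dualGroth_eq_stepProd K (mem_between.mp hnu).2]

end DualGroth

end SymFun

theorem mainTheorem8 {K : Type*} [CommRing K] (t : K) :
    ∃ Φ : SymFun.Sym K ≃ₐ[K] SymFun.Sym K,
      (∀ f : SymFun.Sym K, Φ f = SymFun.perp (SymFun.H t) f) ∧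
      (∀ f : SymFun.Sym K,
        (Φ f : MvPowerSeries ℕ K) = SymFun.substFirst t (f : MvPowerSeries ℕ K)) ∧
      (∀ lam mu : YoungDiagram, mu ≤ lam →
        ∃ hg : SymFun.dualGroth K lam mu ∈ SymFun.Sym K,
          (Φ ⟨SymFun.dualGroth K lam mu, hg⟩ : MvPowerSeries ℕ K)
              = ∑ nu ∈ SymFun.between mu lam,
                  (t ^ SymFun.numCols lam nu) • SymFun.dualGroth K nu mu ∧
          (Φ ⟨SymFun.dualGroth K lam mu, hg⟩ : MvPowerSeries ℕ K)
              = ∑ nu ∈ SymFun.between mu lam,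
                  (t ^ SymFun.numCols nu mu) • SymFun.dualGroth K lam nu) ∧
      (∀ lam : YoungDiagram,
        ∃ hg : SymFun.dualGroth K lam ⊥ ∈ SymFun.Sym K,
          (Φ ⟨SymFun.dualGroth K lam ⊥, hg⟩ : MvPowerSeries ℕ K)
              = ∑ nu ∈ SymFun.between ⊥ lam,
                  (t ^ SymFun.numCols lam nu) • SymFun.dualGroth K nu ⊥ ∧
          (Φ ⟨SymFun.dualGroth K lam ⊥, hg⟩ : MvPowerSeries ℕ K)
              = ∑ nu ∈ SymFun.between ⊥ lam,
                  (t ^ SymFun.numCols nu ⊥) • SymFun.dualGroth K lam nu) := by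
  refine ⟨AlgEquiv.ofBijective (SymFun.substHom t) (SymFun.substHom_bijective t),
    fun f => (SymFun.perp_H t f).symm, fun f => rfl, fun lam mu h => ?_, fun lam => ?_⟩
  · exact ⟨SymFun.dualGroth_mem_Sym h, SymFun.substFirst_dualGroth_left t h,
      SymFun.substFirst_dualGroth_right t h⟩
  · exact ⟨SymFun.dualGroth_mem_Sym bot_le, SymFun.substFirst_dualGroth_left t bot_le,
      SymFun.substFirst_dualGroth_right t bot_le⟩
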